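/- Notation. For $N=2^n$, let $T_N=\left[\begin{smallmatrix}1&0\\1&1\end{smallmatrix}\right]^{\otimes n}$ over $\mathbb F_2$. The polar code of length $N$ with information set $I\subseteq\{0,\dots,N-1\}$ is the set of all words $uT_N$ with $u_i=0$ for $i\notin I$. It is called RM-polar if its minimum distance is the largest one among all polar codes of the same length $N$ and dimension $|I|$. To $l=\sum_{i\in S}2^i<2^n$ with $S\subseteq\{0,\dots,n-1\}$ one associates the negative monomial in $n$ variables $m_l=\prod_{i\in\{0,\dots,n-1\}\setminus S}\bar V_i$, where $\bar V_i=1\oplus V_i$; the rows of $T_N$ are the evaluations of these monomials. Monomials are ordered as follows. If $m=\bar V_{i_0}\cdots\bar V_{i_{s-1}}$ and $m'=\bar V_{j_0}\cdots\bar V_{j_{s-1}}$ have the same degree (indices increasing), then $m\preceq m'$ iff $i_k\le j_k$ for all $k$; if $\deg m<\deg m'$, then $m\preceq m'$ iff $m\preceq m''$ for some divisor $m''$ of $m'$ with $\deg m''=\deg m$; otherwise $m\not\preceq m'$. On indices put $j\preceq i$ iff $m_i\preceq m_j$. A set $\mathcal I_{min}\subseteq\{0,\dots,2^n-1\}$ with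 no two distinct comparable elements is a minimal information set in $n$ variables, and it generates the information set $\{i<2^n : j\preceq i\text{ for some }j\in\mathcal I_{min}\}$ and the corresponding polar code. For $0\le i<n$ let $K_i$ be the number of $l\in I$ such that $\bar V_i$ divides $m_l$. The symmetry $t$ of the code is the number of indices $i$ for which $K_i$ is smallest. The code is partially symmetric if $2\le t\le n-1$ and fully symmetric if $t=n$. An RM-partially symmetric code is an RM-polar code that is partially or fully symmetric. The affine automorphism group $\mathcal A(\mathcal C)$ of a code $\mathcal C$ of length $2^n$ is the group of affine transformations $z\mapsto Az+b$ of $\mathbb F_2^n$ ($A$ invertible) for which the induced permutation of the code positions, identified with their binary representations $z=(z_0,\dots,z_{n-1})$, $z_0$ being the least significant bit, maps $\mathcal C$ to $\mathcal C$. For positive integers $s_1,\dots,s_l$ with sum $n$, $\mathsf{BLTA}(s_1,\dots,s_l)$ is the group of those affine transformations for which $A$ is block lower triangular with diagonal blocks of sizes $s_1,\dots,s_l$. Theorem. Let $n\ge 1$ and $N=2^n$. Let $\mathcal I_{min}$ be a minimal information set in $n$ variables that generates an RM-polar code $\mathcal C$ of length $N$ with $\mathcal A(\mathcal C)=\mathsf{BLTA}(s_1,\dots,s_l)$.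 Then the same set of integers $\mathcal I_{min}$ is a minimal information set in $n+1$ variables, and it generates an RM-partially symmetric code $\mathcal C'$ of length $2N$ with $\mathcal A(\mathcal C')=\mathsf{BLTA}(s_1,\dots,s_{l-1},s_l+1)$. -/

import Mathlib

open scoped Kronecker

namespace RMPSC

/-! ### Polar codes -/

/-- The kernel `T₂`. -/
def kernel : Matrix (Fin 2) (Fin 2) (ZMod 2) := !![1, 0; 1, 1]

/-- The transformation matrix `T_N = T₂^{⊗ n}` with `N = 2 ^ n`. -/
def transform : (n : ℕ) → Matrix (Fin (2 ^ n)) (Fin (2 ^ n)) (ZMod 2)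
  | 0 => 1
  | n + 1 =>
    let e : Fin 2 × Fin (2 ^ n) ≃ Fin (2 ^ (n + 1)) :=
      finProdFinEquiv.trans (finCongr (pow_succ' 2 n).symm)
    Matrix.reindex e e (kernel ⊗ₖ transform n)

/-- The polar code of length `2 ^ n` with information set `I`: all words `u · T_N` such that
`u i = 0` for every frozen index `i ∉ I`. -/
def polarCode (n : ℕ) (I : Finset ℕ) : Submodule (ZMod 2) (Fin (2 ^ n) → ZMod 2) where
  carrier := {x | ∃ u : Fin (2 ^ n) → ZMod 2,
    (∀ i : Fin (2 ^ n), (i : ℕ) ∉ I → u i = 0) ∧ x = Matrix.vecMul u (transform n)}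
  zero_mem' := ⟨0, by simp, by simp⟩
  add_mem' := by
    rintro _ _ ⟨u, hu, rfl⟩ ⟨v, hv, rfl⟩
    exact ⟨u + v, fun i hi => by simp [hu i hi, hv i hi], (Matrix.add_vecMul _ _ _).symm⟩
  smul_mem' := by
    rintro c _ ⟨u, hu, rfl⟩
    exact ⟨c • u, fun i hi => by simp [hu i hi], (Matrix.smul_vecMul _ _ _).symm⟩

/-- The minimum Hamming distance between distinct codewords (`0` for the zero code). -/
noncomputable def minDist {N : ℕ} (C : Submodule (ZMod 2) (Fin N → ZMod 2)) : ℕ :=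
  sInf {d | ∃ x ∈ C, ∃ y ∈ C, x ≠ y ∧ hammingDist x y = d}

/-- `I` is the information set of an RM-polar code of length `2 ^ n`: its minimum distance is the
largest one among the polar codes of the same length and dimension. -/
def IsRMPolar (n : ℕ) (I : Finset ℕ) : Prop :=
  I ⊆ Finset.range (2 ^ n) ∧
    ∀ J : Finset ℕ, J ⊆ Finset.range (2 ^ n) → J.card = I.card →
      minDist (polarCode n J) ≤ minDist (polarCode n I)

/-! ### Monomials and the partial order -/

/-- The variables of the negative monomial `m_l` in `n` variables: `V̄_i` divides `m_l` iff the
`i`-th binary digit of `l` is `0`. A negative monomial is identified with its set of variables. -/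
def vars (n l : ℕ) : Finset (Fin n) :=
  Finset.univ.filter fun i => l.testBit i = false

/-- The binary representation of `k`, least significant digit first. -/
def bits (n k : ℕ) : Fin n → ZMod 2 := fun i => if k.testBit i then 1 else 0

/-- The value of the negative monomial `m_l` at `z`, where `V̄_i = 1 + V_i`. -/
def monomial (n l : ℕ) (z : Fin n → ZMod 2) : ZMod 2 := ∏ i ∈ vars n l, (1 + z i)

/-- The order between monomials of the same degree: comparison of the sorted indices. -/
def SameDegLE {n : ℕ} (s t : Finset (Fin n)) : Prop :=
  ∃ (d : ℕ) (hs : s.card = d) (ht : t.card = d),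
    ∀ k : Fin d, s.orderEmbOfFin hs k ≤ t.orderEmbOfFin ht k

/-- The partial order on monomials. -/
def MonoLE {n : ℕ} (s t : Finset (Fin n)) : Prop :=
  SameDegLE s t ∨ (s.card < t.card ∧ ∃ t' ⊆ t, s.card = t'.card ∧ SameDegLE s t')

/-- The universal partial order `j ⪯ i` on channel indices. The better channel carries the smaller
monomial. -/
def UPO (n j i : ℕ) : Prop := MonoLE (vars n i) (vars n j)

open Classical in
/-- The information set generated by `Imin`: all indices `i < 2 ^ n` with `j ⪯ i` for some
`j ∈ Imin`. -/
noncomputable def infoSet (n : ℕ) (Imin : Finset ℕ) : Finset ℕ :=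
  (Finset.range (2 ^ n)).filter fun i => ∃ j ∈ Imin, UPO n j i

/-- `Imin` is the minimal information set of the information set it generates: none of its elements
is generated by another one. -/
def IsMinInfoSet (n : ℕ) (Imin : Finset ℕ) : Prop :=
  Imin ⊆ Finset.range (2 ^ n) ∧ ∀ i ∈ Imin, ∀ j ∈ Imin, UPO n j i → j = i

/-! ### Symmetry -/

/-- The dimension `K_i` of the `i`-th partial derivative: the number of generating monomials that
include the variable `V̄_i`. -/
def derivDim (n : ℕ) (I : Finset ℕ) (i : Fin n) : ℕ := (I.filter fun l => i ∈ vars n l).card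

/-- The code symmetry: the number of partial derivatives of lowest dimension. -/
def symmetry (n : ℕ) (I : Finset ℕ) : ℕ :=
  (Finset.univ.filter fun i : Fin n => ∀ j : Fin n, derivDim n I i ≤ derivDim n I j).card

/-- `2 ≤ t ≤ n - 1`. -/
def IsPartiallySymmetric (n : ℕ) (I : Finset ℕ) : Prop := 2 ≤ symmetry n I ∧ symmetry n I + 1 ≤ n

/-- `t = n`. -/
def IsFullySymmetric (n : ℕ) (I : Finset ℕ) : Prop := symmetry n I = n

/-- `I` is the information set of an RM-partially symmetric code. -/
def IsRMPSC (n : ℕ) (I : Finset ℕ) : Prop :=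
  IsRMPolar n I ∧ (IsPartiallySymmetric n I ∨ IsFullySymmetric n I)

/-! ### Automorphisms -/

/-- Automorphisms of `C`: permutations `π` of the coordinates that map codewords to codewords. The
permuted word `π(x)` has the entry `x i` at position `π i`. -/
def aut {N : ℕ} (C : Submodule (ZMod 2) (Fin N → ZMod 2)) : Subgroup (Equiv.Perm (Fin N)) where
  carrier := {π | ∀ x ∈ C, x ∘ ⇑π.symm ∈ C}
  one_mem' := fun _ hx => hx
  mul_mem' := fun {a b} ha hb x hx => ha (x ∘ b.symm) (hb x hx)
  inv_mem' := by
    intro a ha x hx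
    have h : Function.Surjective fun y : C => (⟨y.1 ∘ ⇑a.symm, ha y.1 y.2⟩ : C) := by
      refine Finite.surjective_of_injective fun y z hyz => Subtype.ext (funext fun i => ?_)
      simpa using congrFun (congrArg Subtype.val hyz) (a i)
    obtain ⟨y, hy⟩ := h ⟨x, hx⟩
    have hy' : y.1 ∘ ⇑a.symm = x := congrArg Subtype.val hy
    have : x ∘ ⇑(a⁻¹).symm = y.1 := by
      rw [← hy']
      funext i
      exact congrArg y.1 (a.symm_apply_apply i)
    rw [this]
    exact y.2

theorem bits_bijective (n : ℕ) :
    Function.Bijective fun k : Fin (2 ^ n) => bits n k := by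
  refine (Fintype.bijective_iff_injective_and_card _).2 ⟨fun k l h => Fin.ext ?_, by simp⟩
  refine Nat.eq_of_testBit_eq fun i => ?_
  by_cases hi : i < n
  · have := congrFun h ⟨i, hi⟩
    simp only [bits] at this
    cases hk : (k : ℕ).testBit i <;> cases hl : (l : ℕ).testBit i <;> simp [hk, hl] at this ⊢
  · have hp : 2 ^ n ≤ 2 ^ i := Nat.pow_le_pow_right (by norm_num) (not_lt.1 hi)
    rw [Nat.testBit_lt_two_pow (k.2.trans_le hp), Nat.testBit_lt_two_pow (l.2.trans_le hp)]

/-- The bijection between code bit indices and their binary representations. -/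
noncomputable def bitsEquiv (n : ℕ) : Fin (2 ^ n) ≃ (Fin n → ZMod 2) :=
  Equiv.ofBijective _ (bits_bijective n)

/-- The group of affine transformations `z ↦ A z + b` of `n` binary variables, `A` invertible. -/
abbrev GA (n : ℕ) : Type := (Fin n → ZMod 2) ≃ᵃ[ZMod 2] (Fin n → ZMod 2)

/-- The permutation of the code bit indices given by an affine transformation. -/
noncomputable def affinePerm (n : ℕ) : GA n →* Equiv.Perm (Fin (2 ^ n)) where
  toFun g := (bitsEquiv n).trans (g.toEquiv.trans (bitsEquiv n).symm)
  map_one' := by ext; simp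
  map_mul' a b := by ext; simp

/-- The affine automorphism group of `C`. -/
noncomputable def affineAut {n : ℕ} (C : Submodule (ZMod 2) (Fin (2 ^ n) → ZMod 2)) :
    Subgroup (GA n) :=
  (aut C).comap (affinePerm n)

/-- `BLTA(s_1, …, s_l)`: the affine transformations whose matrix is block lower triangular with
diagonal blocks of sizes `s_1, …, s_l`. Here `S.index i` is the number of the block containing the
index `i`. -/
def BLTA {n : ℕ} (S : Composition n) : Subgroup (GA n) where
  carrier := {g | ∀ i j : Fin n, S.index i < S.index j →
    LinearMap.toMatrix' (g.linear : (Fin n → ZMod 2) →ₗ[ZMod 2] (Fin n → ZMod 2)) i j = 0}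
  one_mem' := by
    intro i j hij
    have : i ≠ j := by rintro rfl; exact lt_irrefl _ hij
    change LinearMap.toMatrix' (LinearMap.id) i j = 0
    rw [LinearMap.toMatrix'_id, Matrix.one_apply_ne this]
  mul_mem' := by
    intro a b ha hb
    have h := Matrix.BlockTriangular.mul (b := fun i => OrderDual.toDual (S.index i))
      (M := LinearMap.toMatrix' (a.linear : (Fin n → ZMod 2) →ₗ[ZMod 2] (Fin n → ZMod 2)))
      (N := LinearMap.toMatrix' (b.linear : (Fin n → ZMod 2) →ₗ[ZMod 2] (Fin n → ZMod 2)))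
      (fun i j hij => ha i j hij) (fun i j hij => hb i j hij)
    rw [← LinearMap.toMatrix'_comp] at h
    exact fun i j hij => h hij
  inv_mem' := by
    intro a ha
    set M := LinearMap.toMatrix' (a.linear : (Fin n → ZMod 2) →ₗ[ZMod 2] (Fin n → ZMod 2)) with hM
    set M' := LinearMap.toMatrix'
      ((a⁻¹).linear : (Fin n → ZMod 2) →ₗ[ZMod 2] (Fin n → ZMod 2)) with hM'
    have h1 : M' * M = 1 := by
      rw [hM, hM', ← LinearMap.toMatrix'_comp, ← LinearMap.toMatrix'_id]
      congr 1
      ext1 i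
      ext1
      change a.linear.symm (a.linear _) = _
      simp
    let : Invertible M := invertibleOfLeftInverse _ _ h1
    have h := Matrix.blockTriangular_inv_of_blockTriangular
      (b := fun i => OrderDual.toDual (S.index i)) (M := M) (fun i j hij => ha i j hij)
    rw [Matrix.inv_eq_left_inv h1] at h
    exact fun i j hij => h hij

/-- From `(s_1, …, s_l)` to `(s_1, …, s_l + 1)`. -/
def growLast {n : ℕ} (hn : 0 < n) (S : Composition n) : Composition (n + 1) :=
  have h : S.blocks ≠ [] := fun h => hn.ne (by simpa [h] using S.blocks_sum)
  { blocks := S.blocks.dropLast ++ [S.blocks.getLast h + 1]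
    blocks_pos := fun {i} hi => by
      rcases List.mem_append.1 hi with hi | hi
      · exact S.blocks_pos (List.mem_of_mem_dropLast hi)
      · rw [List.mem_singleton.1 hi]
        exact Nat.succ_pos _
    blocks_sum := by
      have := congrArg List.sum (List.dropLast_append_getLast h)
      rw [List.sum_append, S.blocks_sum] at this
      simp only [List.sum_append, List.sum_singleton] at this ⊢
      omega }


/-- The rows of `T_N` are the evaluations of the negative monomials. -/
theorem transform_apply (n : ℕ) (l k : Fin (2 ^ n)) :
    transform n l k = monomial n l (bits n k) := by
  induction n with
  | zero =>
    have : l = k := Subsingleton.elim (α := Fin 1) l k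
    subst this
    simp [transform, monomial, vars]
  | succ n ih =>
    have hmod : ∀ m : ℕ, ∀ i : Fin n, (m % 2 ^ n).testBit i = m.testBit i := fun m i => by
      simp [Nat.testBit_mod_two_pow, i.2]
    have hdiv : ∀ m : Fin (2 ^ (n + 1)), ((m : ℕ).testBit n = true ↔ (m : ℕ) / 2 ^ n = 1) ∧
        (m : ℕ) / 2 ^ n < 2 := fun m => by
      have h2 : (m : ℕ) / 2 ^ n < 2 := Nat.div_lt_of_lt_mul (by rw [← pow_succ]; exact m.2)
      refine ⟨?_, h2⟩
      rw [Nat.testBit_eq_decide_div_mod_eq, decide_eq_true_iff, Nat.mod_eq_of_lt h2]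
    have h1 : transform (n + 1) l k =
        kernel ⟨l / 2 ^ n, (hdiv l).2⟩ ⟨k / 2 ^ n, (hdiv k).2⟩ *
          transform n ⟨l % 2 ^ n, Nat.mod_lt _ (by positivity)⟩
            ⟨k % 2 ^ n, Nat.mod_lt _ (by positivity)⟩ := rfl
    rw [h1, ih]
    simp only [monomial, vars, bits, Finset.prod_filter, Fin.prod_univ_castSucc, hmod,
      Fin.val_castSucc, Fin.val_last]
    rw [mul_comm]
    congr 1
    have key : ∀ (a b : Fin 2) (p q : Bool), (p = true ↔ (a : ℕ) = 1) → (q = true ↔ (b : ℕ) = 1) →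
        kernel a b = if p = false then 1 + (if q = true then 1 else 0) else 1 := by decide
    exact key ⟨l / 2 ^ n, (hdiv l).2⟩ ⟨k / 2 ^ n, (hdiv k).2⟩ _ _ (hdiv l).1 (hdiv k).1

end RMPSC

namespace RMPSC

open Finset

/-! A monomial is identified with its set of variables, and s ⪯ t then means that for every
threshold k the set s has at most as many elements ≥ k as t (`monoLE_iff`). Generated information
sets thus become decreasing families F of subsets of {0, …, n-1}. Passing from n to n+1 with the
same integers multiplies each generator by the new largest variable, so the new family is `up (n +
1) F`: all sets that lie in F after removal of their largest element (`fam_infoSet_succ`).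
Everything is read off from this description.

RM-polarity. If r is the largest degree in F, being RM-polar forces F to be larger than the family
of all sets of size < r, since otherwise a subcode of a Reed–Muller code with the same dimension
would have a larger distance. Conversely, degrees ≤ r and more elements than that ball suffice. For
a decreasing family, `up` is its neighbourhood, and an isoperimetric inequality of Harper type
(`card_ballFam_le_card_up`) carries the bound from (n, r) to (n+1, r+1).

Symmetry. In the new family a largest element n-1 may always be replaced by n, so the last two
variables have the same derivative dimension, which is the least one because the family is
decreasing.

Automorphisms. For a decreasing code, adding the variable k+1 to the variable k is an automorphism
iff F is closed under the exchange of k for k+1 (`pres_elemTransv_iff_raiseClosed`). Closure at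
every k+1 that is not a block start makes all block lower triangular maps automorphisms
(`closed_of_raiseClosed`, `Closed.pres`). Conversely, an automorphism with a nonzero entry across
the threshold k+1 conjugates a lower triangular transvection into one that reduces to this
elementary map (`Closed.pres_elemTransv`). Closure at the old thresholds passes between F and `up`,
and n never starts a block, so only the last block grows. -/

/-! ### Decreasing families of finite sets -/

/-- The number of elements of `s` that are at least `k`. -/
def cnt (s : Finset ℕ) (k : ℕ) : ℕ := #{i ∈ s | k ≤ i}

theorem cnt_zero (s : Finset ℕ) : cnt s 0 = #s := by simp [cnt]

theorem cnt_mono {s t : Finset ℕ} (h : s ⊆ t) (k : ℕ) : cnt s k ≤ cnt t k :=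
  card_le_card (filter_subset_filter _ h)

theorem cnt_insert {s : Finset ℕ} {a : ℕ} (ha : a ∉ s) (k : ℕ) :
    cnt (insert a s) k = cnt s k + if k ≤ a then 1 else 0 := by
  unfold cnt
  rw [filter_insert]
  split_ifs with h
  · rw [card_insert_of_notMem (by simp [ha])]
  · rfl

theorem cnt_insert_le (s : Finset ℕ) (a k : ℕ) :
    cnt (insert a s) k ≤ cnt s k + if k ≤ a then 1 else 0 := by
  by_cases ha : a ∈ s
  · rw [insert_eq_of_mem ha]; omega
  · rw [cnt_insert ha]

theorem cnt_erase {s : Finset ℕ} {a : ℕ} (ha : a ∈ s) (k : ℕ) :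
    cnt s k = cnt (s.erase a) k + if k ≤ a then 1 else 0 := by
  conv_lhs => rw [← insert_erase ha]
  exact cnt_insert (notMem_erase a s) k

theorem cnt_succ (s : Finset ℕ) (k : ℕ) : cnt s k = cnt s (k + 1) + if k ∈ s then 1 else 0 := by
  unfold cnt
  split_ifs with h
  · rw [← card_insert_of_notMem (a := k) (by simp)]
    congr 1
    ext i
    simp only [mem_filter, mem_insert]
    constructor
    · rintro ⟨hi, hk⟩
      rcases hk.eq_or_lt with rfl | hk
      · exact Or.inl rfl
      · exact Or.inr ⟨hi, hk⟩
    · rintro (rfl | ⟨hi, hk⟩)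
      · exact ⟨h, le_rfl⟩
      · exact ⟨hi, by omega⟩
  · rw [add_zero]
    congr 1
    ext i
    simp only [mem_filter]
    refine and_congr_right fun hi => ?_
    have : i ≠ k := fun h' => h (h' ▸ hi)
    omega

theorem cnt_eq_zero {n : ℕ} {s : Finset ℕ} (hs : s ⊆ range n) {k : ℕ} (hk : n ≤ k) :
    cnt s k = 0 := by
  unfold cnt
  rw [card_eq_zero, filter_eq_empty_iff]
  intro i hi
  have := mem_range.1 (hs hi)
  omega

/-- The exchange of the element `i` for `j`. -/
def exch (s : Finset ℕ) (i j : ℕ) : Finset ℕ := insert j (s.erase i)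

theorem cnt_exch {s : Finset ℕ} {i j : ℕ} (hi : i ∈ s) (hj : j ∉ s) (k : ℕ) :
    cnt (exch s i j) k + (if k ≤ i then 1 else 0) = cnt s k + if k ≤ j then 1 else 0 := by
  unfold exch
  rw [cnt_insert (fun h => hj (mem_of_mem_erase h)), cnt_erase hi k]
  omega

/-- The family `I` of subsets of `{0, …, n - 1}` contains each set that has at most as many elements
`≥ k` as some member of `I`, for all thresholds `k ∈ T`. -/
def Closed (n : ℕ) (T : Set ℕ) (I : Finset (Finset ℕ)) : Prop :=
  ∀ t ∈ I, ∀ s ⊆ range n, (∀ k ∈ T, cnt s k ≤ cnt t k) → s ∈ I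

theorem Closed.subset_mem {n : ℕ} {T : Set ℕ} {I : Finset (Finset ℕ)} (h : Closed n T I)
    (hI : I ⊆ (range n).powerset) {s t : Finset ℕ} (ht : t ∈ I) (hs : s ⊆ t) : s ∈ I :=
  h t ht s (hs.trans (mem_powerset.1 (hI ht))) fun k _ => cnt_mono hs k

theorem Closed.exch_mem {n : ℕ} {T : Set ℕ} {I : Finset (Finset ℕ)} (h : Closed n T I)
    (hI : I ⊆ (range n).powerset) {s : Finset ℕ} (hs : s ∈ I) {i j : ℕ} (hi : i ∈ s) (hj : j ∉ s)
    (hij : j < i) : exch s i j ∈ I := by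
  have hsn := mem_powerset.1 (hI hs)
  refine h s hs _ ?_ fun k _ => ?_
  · refine insert_subset (mem_range.2 (hij.trans (mem_range.1 (hsn hi)))) ?_
    exact (erase_subset _ _).trans hsn
  · have := cnt_exch hi hj k
    split_ifs at this <;> omega

/-- Closure of a family under the exchange of `k` for `k + 1`. -/
def RaiseClosed (I : Finset (Finset ℕ)) (k : ℕ) : Prop :=
  ∀ t ∈ I, k ∈ t → k + 1 ∉ t → exch t k (k + 1) ∈ I

/-- A decreasing family that is closed under raising elements across the thresholds outside `T`
depends on the thresholds in `T` only. -/
theorem closed_of_raiseClosed {n : ℕ} {T : Set ℕ} {I : Finset (Finset ℕ)}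
    (h : Closed n Set.univ I) (h0 : 0 ∈ T)
    (hr : ∀ k, k + 1 < n → k + 1 ∉ T → RaiseClosed I k) : Closed n T I := by
  intro t ht s hs hc
  -- Induction on the total deficit of t against s; raising one element of t lowers it.
  obtain ⟨e, he⟩ : ∃ e, e = ∑ k ∈ range n, (cnt s k - cnt t k) := ⟨_, rfl⟩
  induction e using Nat.strong_induction_on generalizing t with
  | _ e ih =>
    by_cases hall : ∀ k, cnt s k ≤ cnt t k
    · exact h t ht s hs fun k _ => hall k
    push Not at hall
    -- At the first violated threshold k, comparison with k - 1 gives k - 1 ∈ t. If no element could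
    -- be raised, t would contain k - 1, k, k + 1, … with the violation persisting, but s has no
    -- elements ≥ n.
    obtain ⟨j, hj1, hj2, hj3⟩ : ∃ j, j ∈ t ∧ j + 1 ∉ t ∧ cnt t (j + 1) < cnt s (j + 1) := by
      by_contra! hno
      have hfirst := Nat.find_spec hall
      have hmin := fun m (hm : m < Nat.find hall) => Nat.find_min hall hm
      set k := Nat.find hall with hk
      have hk0 : k ≠ 0 := by
        intro h
        rw [h] at hfirst
        exact absurd (hc 0 h0) (by omega)
      have hpos : ∀ d, k - 1 + d ∈ t ∧ cnt t (k + d) < cnt s (k + d) := by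
        intro d
        induction d with
        | zero =>
          refine ⟨?_, hfirst⟩
          have h1 := hmin (k - 1) (by omega)
          have h2 := cnt_succ s (k - 1)
          have h3 := cnt_succ t (k - 1)
          rw [show k - 1 + 1 = k by omega] at h2 h3
          by_contra hn
          rw [add_zero] at hn
          simp only [hn, if_false] at h3
          omega
        | succ d ihd =>
          have hin : k + d ∈ t := by
            by_contra hn
            have := hno (k - 1 + d) ihd.1 (by rwa [show k - 1 + d + 1 = k + d by omega])
            rw [show k - 1 + d + 1 = k + d by omega] at this
            omega
          refine ⟨by rwa [show k - 1 + (d + 1) = k + d by omega], ?_⟩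
          have h2 := cnt_succ s (k + d)
          have h3 := cnt_succ t (k + d)
          rw [if_pos hin] at h3
          rw [← add_assoc]
          split_ifs at h2 <;> omega
      have h1 := (hpos n).2
      have h2 := cnt_eq_zero hs (k := k + n) (by omega)
      omega
    have hjn : j + 1 < n := by
      by_contra hn
      have := cnt_eq_zero hs (k := j + 1) (by omega)
      omega
    have hjT : j + 1 ∉ T := fun hT => absurd (hc _ hT) (by omega)
    have hcnt : ∀ k, cnt (exch t j (j + 1)) k = cnt t k + if k = j + 1 then 1 else 0 := by
      intro k
      have := cnt_exch hj1 hj2 k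
      split_ifs at this ⊢ <;> omega
    refine ih _ ?_ _ (hr j hjn hjT t ht hj1 hj2) (fun k hk => ?_) rfl
    · rw [he]
      refine sum_lt_sum (fun k _ => ?_) ⟨j + 1, mem_range.2 hjn, ?_⟩
      · rw [hcnt]; omega
      · rw [hcnt, if_pos rfl]; omega
    · rw [hcnt]
      exact (hc k hk).trans (by omega)

/-! ### Removing the largest element -/

/-- The set `s` without its largest element. -/
def tail (s : Finset ℕ) : Finset ℕ := s.erase (s.sup id)

theorem tail_subset (s : Finset ℕ) : tail s ⊆ s := erase_subset _ _

theorem sup_id_mem {s : Finset ℕ} (hs : s.Nonempty) : s.sup id ∈ s := by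
  obtain ⟨i, hi, h⟩ := exists_mem_eq_sup s hs id
  rw [h]; exact hi

theorem sup_id_eq {s : Finset ℕ} {a : ℕ} (ha : a ∈ s) (h : ∀ i ∈ s, i ≤ a) : s.sup id = a :=
  le_antisymm (Finset.sup_le h) (le_sup (f := id) ha)

theorem tail_eq {s : Finset ℕ} {a : ℕ} (ha : a ∈ s) (h : ∀ i ∈ s, i ≤ a) : tail s = s.erase a := by
  rw [tail, sup_id_eq ha h]

/-- If some element is ≥ k, so is the largest one; otherwise both counts are 0 and truncated
subtraction agrees. -/
theorem cnt_tail (s : Finset ℕ) (k : ℕ) : cnt (tail s) k = cnt s k - 1 := by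
  rcases s.eq_empty_or_nonempty with rfl | hs
  · simp [tail, cnt]
  · rw [cnt_erase (sup_id_mem hs) k]
    change cnt (tail s) k = cnt (tail s) k + _ - 1
    split_ifs with h
    · rfl
    · have : cnt s k = 0 := by
        unfold cnt
        rw [card_eq_zero, filter_eq_empty_iff]
        intro i hi hk
        exact h (hk.trans (le_sup (f := id) hi))
      have := cnt_mono (tail_subset s) k
      omega

theorem tail_subset_range {n : ℕ} {s : Finset ℕ} (hs : s ⊆ range (n + 1)) : tail s ⊆ range n := by
  intro i hi
  have h1 := mem_range.1 (hs (tail_subset s hi))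
  have h2 : i ≠ n := by
    rintro rfl
    have := sup_id_eq (tail_subset s hi) fun j hj => by
      have := mem_range.1 (hs hj)
      omega
    rw [tail, this] at hi
    exact notMem_erase i s hi
  rw [mem_range]; omega

/-- The family of all subsets of `{0, …, n - 1}` that lie in `I` after removal of the largest
element. -/
def up (n : ℕ) (I : Finset (Finset ℕ)) : Finset (Finset ℕ) := {s ∈ (range n).powerset | tail s ∈ I}

theorem mem_up {n : ℕ} {I : Finset (Finset ℕ)} {s : Finset ℕ} :
    s ∈ up n I ↔ s ⊆ range n ∧ tail s ∈ I := by
  simp [up]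

theorem up_subset (n : ℕ) (I : Finset (Finset ℕ)) : up n I ⊆ (range n).powerset := filter_subset _ _

theorem Closed.up {n : ℕ} {T : Set ℕ} {I : Finset (Finset ℕ)} (h : Closed n T I) :
    Closed (n + 1) T (up (n + 1) I) := by
  intro t ht s hs hc
  rw [mem_up] at ht ⊢
  refine ⟨hs, h _ ht.2 _ (tail_subset_range hs) fun k hk => ?_⟩
  rw [cnt_tail, cnt_tail]
  have := hc k hk
  omega

theorem insert_mem_up {n : ℕ} {I : Finset (Finset ℕ)} {s : Finset ℕ} (hs : s ⊆ range n) :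
    insert n s ∈ up (n + 1) I ↔ s ∈ I := by
  have hn : n ∉ s := fun h => by simpa using hs h
  rw [mem_up, tail_eq (mem_insert_self n s), erase_insert hn]
  · refine and_iff_right (insert_subset (by simp) (hs.trans ?_))
    exact range_subset_range.2 (Nat.le_succ n)
  · intro i hi
    rcases mem_insert.1 hi with rfl | hi
    · exact le_rfl
    · exact (mem_range.1 (hs hi)).le

/-- A set with n but without n + 1 has n as its largest element, so raising it changes only the
element that `tail` discards. -/
theorem raiseClosed_up_last {n : ℕ} {I : Finset (Finset ℕ)} :
    RaiseClosed (up (n + 2) I) n := by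
  intro t ht hk hk1
  have htn : ∀ i ∈ t, i ≤ n := by
    intro i hi
    have h1 := mem_range.1 ((mem_up.1 ht).1 hi)
    have h2 : i ≠ n + 1 := fun h => hk1 (h ▸ hi)
    omega
  have h := (mem_up.1 ht).2
  rw [tail_eq hk htn] at h
  refine (insert_mem_up fun i hi => ?_).2 h
  have := htn i (mem_of_mem_erase hi)
  rw [mem_range]; omega

/-- Adjoining n as a largest element shields the exchange below it from `tail`. -/
theorem raiseClosed_of_up {n k : ℕ} {I : Finset (Finset ℕ)} (hI : I ⊆ (range n).powerset)
    (hk : k + 1 < n) (h : RaiseClosed (up (n + 1) I) k) : RaiseClosed I k := by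
  intro t ht hkt hkt'
  have htn := mem_powerset.1 (hI ht)
  have h1 := h (insert n t) ((insert_mem_up htn).2 ht) (mem_insert_of_mem hkt)
    (by simp only [mem_insert, not_or]; exact ⟨by omega, hkt'⟩)
  have h2 : exch (insert n t) k (k + 1) = insert n (exch t k (k + 1)) := by
    unfold exch
    rw [erase_insert_of_ne (by omega), insert_comm]
  rw [h2, insert_mem_up] at h1
  · exact h1
  · exact insert_subset (by simpa using hk) ((erase_subset _ _).trans htn)

/-! ### An isoperimetric inequality -/

/-- The members of `J` that contain `n`, with `n` removed. -/
def link (n : ℕ) (J : Finset (Finset ℕ)) : Finset (Finset ℕ) :=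
  {s ∈ (range n).powerset | insert n s ∈ J}

/-- The members of `J` that do not contain `n`. -/
def deletion (n : ℕ) (J : Finset (Finset ℕ)) : Finset (Finset ℕ) := {s ∈ (range n).powerset | s ∈ J}

theorem card_eq_deletion_add_link {n : ℕ} {J : Finset (Finset ℕ)}
    (hJ : J ⊆ (range (n + 1)).powerset) : #J = #(deletion n J) + #(link n J) := by
  rw [← card_filter_add_card_filter_not (s := J) (fun s => n ∉ s)]
  congr 1
  · congr 1
    ext s
    simp only [mem_filter, deletion, mem_powerset]
    constructor
    · rintro ⟨hs, hn⟩
      have h := mem_powerset.1 (hJ hs)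
      rw [range_add_one] at h
      exact ⟨(subset_insert_iff_of_notMem hn).1 h, hs⟩
    · rintro ⟨hs, h⟩
      exact ⟨h, fun hn => by simpa using hs hn⟩
  · refine card_nbij' (fun s => s.erase n) (fun s => insert n s) ?_ ?_ ?_ ?_
    · intro s hs
      simp only [coe_filter, not_not, Set.mem_ofPred_eq] at hs
      have h := mem_powerset.1 (hJ hs.1)
      rw [range_add_one] at h
      simp only [link, coe_filter, Set.mem_ofPred_eq, mem_powerset, insert_erase hs.2]
      exact ⟨subset_insert_iff.1 h, hs.1⟩
    · intro s hs
      simp only [link, coe_filter, Set.mem_ofPred_eq] at hs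
      simp [hs.2]
    · intro s hs
      simp only [coe_filter, not_not, Set.mem_ofPred_eq] at hs
      exact insert_erase hs.2
    · intro s hs
      simp only [link, coe_filter, Set.mem_ofPred_eq, mem_powerset] at hs
      exact erase_insert fun hn => by simpa using hs.1 hn

/-- The subsets of `{0, …, n - 1}` with less than `r` elements. -/
def ballFam (n r : ℕ) : Finset (Finset ℕ) := {s ∈ (range n).powerset | #s < r}

/-- Pascal's rule, by splitting on membership of n. -/
theorem card_ballFam_succ (n r : ℕ) :
    #(ballFam (n + 1) (r + 1)) = #(ballFam n (r + 1)) + #(ballFam n r) := by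
  rw [card_eq_deletion_add_link (J := ballFam (n + 1) (r + 1)) (filter_subset _ _)]
  have hsub : range n ⊆ range (n + 1) := range_subset_range.2 (Nat.le_succ n)
  congr 2
  · ext s
    simp only [deletion, ballFam, mem_filter, mem_powerset]
    exact ⟨fun h => ⟨h.1, h.2.2⟩, fun h => ⟨h.1, h.1.trans hsub, h.2⟩⟩
  · ext s
    simp only [link, ballFam, mem_filter, mem_powerset]
    refine and_congr_right fun hs => ?_
    rw [card_insert_of_notMem fun hn => by simpa using hs hn]
    exact ⟨fun h => by omega, fun h => ⟨insert_subset (by simp) (hs.trans hsub), by omega⟩⟩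

theorem Closed.deletion {n : ℕ} {J : Finset (Finset ℕ)} (h : Closed (n + 1) Set.univ J) :
    Closed n Set.univ (deletion n J) := by
  intro t ht s hs hc
  simp only [RMPSC.deletion, mem_filter, mem_powerset] at ht ⊢
  exact ⟨hs, h t ht.2 s (hs.trans (range_subset_range.2 (Nat.le_succ n))) hc⟩

theorem Closed.link {n : ℕ} {J : Finset (Finset ℕ)} (h : Closed (n + 1) Set.univ J) :
    Closed n Set.univ (link n J) := by
  intro t ht s hs hc
  simp only [RMPSC.link, mem_filter, mem_powerset] at ht ⊢
  refine ⟨hs, h _ ht.2 _ ?_ fun k hk => ?_⟩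
  · exact insert_subset (by simp) (hs.trans (range_subset_range.2 (Nat.le_succ n)))
  · rw [cnt_insert fun hn => by simpa using hs hn, cnt_insert fun hn => by simpa using ht.1 hn]
    have := hc k hk
    omega

/-- Exchanging the largest element of s for n gives a set in J that dominates s. -/
theorem up_link_subset {n : ℕ} {J : Finset (Finset ℕ)} (h : Closed (n + 1) Set.univ J) :
    up n (link n J) ⊆ deletion n J := by
  intro s hs
  rw [mem_up] at hs
  simp only [link, deletion, mem_filter, mem_powerset] at hs ⊢
  refine ⟨hs.1, h _ hs.2.2 s (hs.1.trans (range_subset_range.2 (Nat.le_succ n))) fun k _ => ?_⟩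
  rw [cnt_insert fun hn => by simpa using hs.2.1 hn, cnt_tail]
  split_ifs with hk
  · omega
  · rw [cnt_eq_zero hs.1 (by omega)]

theorem link_up {n : ℕ} (J : Finset (Finset ℕ)) : link n (up (n + 1) J) = deletion n J := by
  ext s
  simp only [link, deletion, mem_filter, mem_powerset]
  exact and_congr_right fun hs => insert_mem_up hs

theorem deletion_up {n : ℕ} (J : Finset (Finset ℕ)) :
    deletion n (up (n + 1) J) = up n (deletion n J) := by
  ext s
  simp only [deletion, mem_filter, mem_powerset, mem_up]
  refine and_congr_right fun hs => ?_
  exact ⟨fun h => ⟨(tail_subset s).trans hs, h.2⟩,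
    fun h => ⟨hs.trans (range_subset_range.2 (Nat.le_succ n)), h.2⟩⟩

theorem card_up_succ (n : ℕ) (J : Finset (Finset ℕ)) :
    #(up (n + 1) J) = #(up n (deletion n J)) + #(deletion n J) := by
  rw [card_eq_deletion_add_link (up_subset _ _), link_up, deletion_up]

/-- A case of Harper's inequality: if a decreasing family is at least as large as a Hamming ball,
then its neighbourhood is at least as large as the ball of the next radius. -/
theorem card_ballFam_le_card_up {n r : ℕ} {J : Finset (Finset ℕ)} (hJ : J.Nonempty)
    (hsub : J ⊆ (range n).powerset) (h : Closed n Set.univ J) (hc : #(ballFam n r) ≤ #J) :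
    #(ballFam n (r + 1)) ≤ #(up n J) := by
  induction n generalizing r J with
  | zero =>
    obtain ⟨s, hs⟩ := hJ
    refine card_le_card fun t ht => ?_
    have ht := mem_powerset.1 (mem_of_mem_filter t ht)
    have h0 := mem_powerset.1 (hsub hs)
    simp only [range_zero, subset_empty] at ht h0
    subst ht h0
    exact mem_up.2 ⟨by simp, by simpa [tail] using hs⟩
  | succ n ih =>
    have hdel : (deletion n J).Nonempty := by
      obtain ⟨s, hs⟩ := hJ
      exact ⟨∅, by simp [deletion, h.subset_mem hsub hs (empty_subset s)]⟩
    -- If the deletion were smaller than its ball, Pascal's rule would make the link larger than the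
    -- ball of radius one less; the induction hypothesis for the link, whose neighbourhood lies in
    -- the deletion, contradicts this.
    have hge : #(ballFam n r) ≤ #(deletion n J) := by
      cases r with
      | zero => simp [ballFam]
      | succ r =>
        by_contra! hlt
        rw [card_eq_deletion_add_link hsub, card_ballFam_succ] at hc
        have h1 : #(ballFam n r) < #(link n J) := by omega
        have hne : (link n J).Nonempty := card_pos.1 (by omega)
        have h2 := ih hne (filter_subset _ _) h.link h1.le
        have h3 := card_le_card (up_link_subset h)
        omega
    have := ih hdel (filter_subset _ _) h.deletion hge
    rw [card_ballFam_succ, card_up_succ]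
    omega

/-- Over the enlarged ground set, `up` splits into the neighbourhood of J over the old ground set
and a copy of J itself. The copy supplies the strictness. -/
theorem card_ballFam_lt_card_up {n r : ℕ} {J : Finset (Finset ℕ)} (hJ : J.Nonempty)
    (hsub : J ⊆ (range n).powerset) (h : Closed n Set.univ J) (hc : #(ballFam n r) < #J) :
    #(ballFam (n + 1) (r + 1)) < #(up (n + 1) J) := by
  have h1 := card_ballFam_le_card_up hJ hsub h hc.le
  have h2 : deletion n J = J := by
    ext s
    simp only [deletion, mem_filter, and_iff_right_iff_imp]
    exact fun hs => hsub hs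
  rw [card_ballFam_succ, card_up_succ, h2]
  omega

/-! ### The order on monomials -/

/-- A set of variables as a set of natural numbers. -/
def toNat {n : ℕ} (s : Finset (Fin n)) : Finset ℕ := s.map Fin.valEmbedding

theorem cnt_toNat {n : ℕ} (s : Finset (Fin n)) (k : ℕ) :
    cnt (toNat s) k = #(s.filter fun i : Fin n => k ≤ (i : ℕ)) := by
  unfold cnt toNat
  rw [filter_map, card_map]
  rfl

theorem card_toNat {n : ℕ} (s : Finset (Fin n)) : #(toNat s) = #s := card_map _

theorem card_filter_orderEmbOfFin {α : Type*} [LinearOrder α] (s : Finset α) {d : ℕ} (h : #s = d)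
    (p : α → Prop) [DecidablePred p] :
    #{i ∈ s | p i} = #{k : Fin d | p (s.orderEmbOfFin h k)} := by
  rw [← card_map (s.orderEmbOfFin h).toEmbedding]
  congr 1
  ext i
  simp only [mem_filter, mem_map, mem_univ, true_and]
  constructor
  · rintro ⟨hi, hp⟩
    have : i ∈ Set.range (s.orderEmbOfFin h) := by rw [range_orderEmbOfFin]; exact hi
    obtain ⟨k, rfl⟩ := this
    exact ⟨k, hp, rfl⟩
  · rintro ⟨k, hp, rfl⟩
    exact ⟨orderEmbOfFin_mem s h k, hp⟩

theorem sameDegLE_iff {n : ℕ} {s t : Finset (Fin n)} :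
    SameDegLE s t ↔ #s = #t ∧ ∀ k, cnt (toNat s) k ≤ cnt (toNat t) k := by
  constructor
  · rintro ⟨d, hs, ht, h⟩
    refine ⟨hs.trans ht.symm, fun k => ?_⟩
    rw [cnt_toNat, cnt_toNat, card_filter_orderEmbOfFin s hs, card_filter_orderEmbOfFin t ht]
    refine card_le_card fun i hi => ?_
    simp only [mem_filter, mem_univ, true_and] at hi ⊢
    exact hi.trans (h i)
  · rintro ⟨hst, h⟩
    refine ⟨_, hst, rfl, fun k => ?_⟩
    by_contra! hlt
    -- If the k-th element of s exceeds that of t, then with this element as threshold t has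
    -- strictly fewer elements above it.
    have h1 := h (s.orderEmbOfFin hst k : Fin n)
    rw [cnt_toNat, cnt_toNat, card_filter_orderEmbOfFin s hst,
      card_filter_orderEmbOfFin t rfl] at h1
    refine absurd h1 (not_le.2 (card_lt_card ⟨fun j hj => ?_, fun hsub => ?_⟩))
    · simp only [mem_filter, mem_univ, true_and, Fin.val_fin_le, OrderEmbedding.le_iff_le] at hj ⊢
      exact ((t.orderEmbOfFin rfl).lt_iff_lt.1 (hlt.trans_le hj)).le
    · have := hsub (x := k) (mem_filter.2 ⟨mem_univ k, le_rfl⟩)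
      simp only [mem_filter, mem_univ, true_and, Fin.val_fin_le] at this
      exact absurd this (not_le.2 hlt)

theorem monoLE_iff {n : ℕ} {s t : Finset (Fin n)} :
    MonoLE s t ↔ ∀ k, cnt (toNat s) k ≤ cnt (toNat t) k := by
  constructor
  · rintro (h | ⟨-, t', ht', -, h⟩)
    · exact (sameDegLE_iff.1 h).2
    · exact fun k => ((sameDegLE_iff.1 h).2 k).trans (cnt_mono (map_subset_map.2 ht') k)
  · intro h
    -- The divisor is found by discarding the smallest elements of t: thresholds above the discarded
    -- element are unaffected, and below it all of the at least #s remaining elements count.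
    have key : ∀ (e : ℕ) (t : Finset (Fin n)), #t = #s + e →
        (∀ k, cnt (toNat s) k ≤ cnt (toNat t) k) → ∃ t' ⊆ t, #s = #t' ∧ SameDegLE s t' := by
      intro e
      induction e with
      | zero => exact fun t ht h => ⟨t, Subset.rfl, ht.symm, sameDegLE_iff.2 ⟨ht.symm, h⟩⟩
      | succ e ih =>
        intro t ht h
        have hne : t.Nonempty := card_pos.1 (by omega)
        have hmem := min'_mem t hne
        have hle := fun i hi => min'_le t i hi
        set a := t.min' hne
        have hcard : #(t.erase a) = #s + e := by rw [card_erase_of_mem hmem]; omega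
        obtain ⟨t', ht', h'⟩ := ih (t.erase a) hcard fun k => by
          rcases Nat.lt_or_ge a k with hk | hk
          · refine (h k).trans_eq ?_
            rw [cnt_toNat, cnt_toNat, filter_erase, erase_eq_of_notMem]
            simp only [mem_filter, not_and, not_le]
            exact fun _ => hk
          · have h1 : cnt (toNat (t.erase a)) k = #(t.erase a) := by
              rw [cnt_toNat, filter_true_of_mem]
              exact fun i hi => hk.trans (hle i (mem_of_mem_erase hi))
            have h2 : cnt (toNat s) k ≤ #s := by
              rw [← card_toNat]; exact card_filter_le _ _
            omega
        exact ⟨t', ht'.trans (erase_subset _ _), h'⟩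
    have hcard : #s ≤ #t := by simpa [cnt_zero, card_toNat] using h 0
    rcases hcard.eq_or_lt with hc | hc
    · exact Or.inl (sameDegLE_iff.2 ⟨hc, h⟩)
    · exact Or.inr ⟨hc, key (#t - #s) t (by omega) h⟩

/-! ### Indices and sets of variables -/

/-- The variables of `m_l` as a set of natural numbers. -/
def nvars (n l : ℕ) : Finset ℕ := {i ∈ range n | l.testBit i = false}

theorem mem_nvars {n l i : ℕ} : i ∈ nvars n l ↔ i < n ∧ l.testBit i = false := by simp [nvars]

theorem toNat_vars (n l : ℕ) : toNat (vars n l) = nvars n l := by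
  ext i
  simp only [toNat, vars, mem_map, mem_filter, mem_univ, true_and, mem_nvars,
    Fin.valEmbedding_apply]
  constructor
  · rintro ⟨j, hj, rfl⟩
    exact ⟨j.2, hj⟩
  · rintro ⟨hi, h⟩
    exact ⟨⟨i, hi⟩, h, rfl⟩

theorem nvars_subset (n l : ℕ) : nvars n l ⊆ range n := filter_subset _ _

theorem UPO_iff {n j i : ℕ} : UPO n j i ↔ ∀ k, cnt (nvars n i) k ≤ cnt (nvars n j) k := by
  rw [UPO, monoLE_iff, toNat_vars, toNat_vars]

theorem nvars_injOn (n : ℕ) : Set.InjOn (nvars n) (range (2 ^ n)) := by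
  intro a ha b hb h
  refine Nat.eq_of_testBit_eq fun i => ?_
  have ha := mem_range.1 ha
  have hb := mem_range.1 hb
  by_cases hi : i < n
  · have := Finset.ext_iff.1 h i
    simp only [mem_nvars, hi, true_and] at this
    cases h1 : a.testBit i <;> cases h2 : b.testBit i <;> simp_all
  · have hp : 2 ^ n ≤ 2 ^ i := Nat.pow_le_pow_right (by norm_num) (not_lt.1 hi)
    rw [Nat.testBit_lt_two_pow (ha.trans_le hp), Nat.testBit_lt_two_pow (hb.trans_le hp)]

/-- The sets of variables of the monomials with indices in `I`. -/
def fam (n : ℕ) (I : Finset ℕ) : Finset (Finset ℕ) := I.image (nvars n)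

theorem fam_subset (n : ℕ) (I : Finset ℕ) : fam n I ⊆ (range n).powerset := by
  intro s hs
  obtain ⟨l, -, rfl⟩ := mem_image.1 hs
  exact mem_powerset.2 (nvars_subset n l)

theorem card_fam {n : ℕ} {I : Finset ℕ} (hI : I ⊆ range (2 ^ n)) : #(fam n I) = #I :=
  card_image_of_injOn ((nvars_injOn n).mono (coe_subset.2 hI))

theorem image_nvars (n : ℕ) : (range (2 ^ n)).image (nvars n) = (range n).powerset := by
  refine eq_of_subset_of_card_le ?_ ?_
  · exact fam_subset n _
  · rw [card_image_of_injOn (nvars_injOn n)]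
    simp

theorem exists_nvars_eq {n : ℕ} {s : Finset ℕ} (hs : s ⊆ range n) :
    ∃ l < 2 ^ n, nvars n l = s := by
  have : s ∈ (range (2 ^ n)).image (nvars n) := by rw [image_nvars]; exact mem_powerset.2 hs
  obtain ⟨l, hl, h⟩ := mem_image.1 this
  exact ⟨l, mem_range.1 hl, h⟩

theorem exists_fam_eq {n : ℕ} {J : Finset (Finset ℕ)} (hJ : J ⊆ (range n).powerset) :
    ∃ I ⊆ range (2 ^ n), fam n I = J := by
  refine ⟨{l ∈ range (2 ^ n) | nvars n l ∈ J}, filter_subset _ _, ?_⟩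
  ext s
  simp only [fam, mem_image, mem_filter, mem_range]
  constructor
  · rintro ⟨l, ⟨-, h⟩, rfl⟩
    exact h
  · intro hs
    obtain ⟨l, hl, rfl⟩ := exists_nvars_eq (mem_powerset.1 (hJ hs))
    exact ⟨l, ⟨hl, hs⟩, rfl⟩

theorem infoSet_subset (n : ℕ) (Imin : Finset ℕ) : infoSet n Imin ⊆ range (2 ^ n) := by
  classical
  exact filter_subset _ _

theorem mem_fam_infoSet {n : ℕ} {Imin : Finset ℕ} {s : Finset ℕ} :
    s ∈ fam n (infoSet n Imin) ↔ s ⊆ range n ∧ ∃ j ∈ Imin, ∀ k, cnt s k ≤ cnt (nvars n j) k := by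
  simp only [fam, infoSet, mem_image, mem_filter, mem_range, UPO_iff]
  constructor
  · rintro ⟨l, ⟨-, h⟩, rfl⟩
    exact ⟨nvars_subset n l, h⟩
  · rintro ⟨hs, h⟩
    obtain ⟨l, hl, rfl⟩ := exists_nvars_eq hs
    exact ⟨l, ⟨hl, h⟩, rfl⟩

theorem closed_fam_infoSet (n : ℕ) (Imin : Finset ℕ) :
    Closed n Set.univ (fam n (infoSet n Imin)) := by
  intro t ht s hs hc
  rw [mem_fam_infoSet] at ht ⊢
  obtain ⟨-, j, hj, h⟩ := ht
  exact ⟨hs, j, hj, fun k => (hc k trivial).trans (h k)⟩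

theorem nvars_succ {n l : ℕ} (hl : l < 2 ^ n) : nvars (n + 1) l = insert n (nvars n l) := by
  ext i
  rw [mem_insert, mem_nvars, mem_nvars]
  constructor
  · rintro ⟨h1, h2⟩
    rcases Nat.lt_succ_iff_lt_or_eq.1 h1 with h | h
    · exact Or.inr ⟨h, h2⟩
    · exact Or.inl h
  · rintro (rfl | ⟨h1, h2⟩)
    · exact ⟨Nat.lt_succ_self i, Nat.testBit_lt_two_pow hl⟩
    · exact ⟨by omega, h2⟩

theorem cnt_nvars_succ {n l : ℕ} (hl : l < 2 ^ n) (k : ℕ) :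
    cnt (nvars (n + 1) l) k = cnt (nvars n l) k + if k ≤ n then 1 else 0 := by
  rw [nvars_succ hl, cnt_insert fun h => by simpa using nvars_subset n l h]

/-- Each generator gains the element n, which adds one to every count at k ≤ n. Bounding the counts
of s by these is the same as bounding those of `tail s` by the old ones. -/
theorem fam_infoSet_succ {n : ℕ} {Imin : Finset ℕ} (hI : Imin ⊆ range (2 ^ n)) :
    fam (n + 1) (infoSet (n + 1) Imin) = up (n + 1) (fam n (infoSet n Imin)) := by
  ext s
  rw [mem_fam_infoSet, mem_up, mem_fam_infoSet]
  refine and_congr_right fun hs => ?_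
  rw [and_iff_right (tail_subset_range hs)]
  refine exists_congr fun j => and_congr_right fun hj => forall_congr' fun k => ?_
  rw [cnt_nvars_succ (mem_range.1 (hI hj)), cnt_tail]
  split_ifs with hk
  · omega
  · rw [cnt_eq_zero hs (by omega)]
    simp

theorem UPO_succ {n i j : ℕ} (hi : i < 2 ^ n) (hj : j < 2 ^ n) :
    UPO (n + 1) j i ↔ UPO n j i := by
  rw [UPO_iff, UPO_iff]
  refine forall_congr' fun k => ?_
  rw [cnt_nvars_succ hi, cnt_nvars_succ hj]
  omega

theorem IsMinInfoSet.succ {n : ℕ} {Imin : Finset ℕ} (h : IsMinInfoSet n Imin) :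
    IsMinInfoSet (n + 1) Imin := by
  refine ⟨h.1.trans (range_subset_range.2 ?_), fun i hi j hj hij => h.2 i hi j hj ?_⟩
  · exact Nat.pow_le_pow_right (by norm_num) (Nat.le_succ n)
  · exact (UPO_succ (mem_range.1 (h.1 hi)) (mem_range.1 (h.1 hj))).1 hij

/-! ### Symmetry -/

theorem derivDim_eq {n : ℕ} {I : Finset ℕ} (hI : I ⊆ range (2 ^ n)) (i : Fin n) :
    derivDim n I i = #{s ∈ fam n I | (i : ℕ) ∈ s} := by
  rw [derivDim, fam, filter_image, card_image_of_injOn]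
  · congr 1
    ext l
    simp [vars, mem_nvars]
  · exact (nvars_injOn n).mono (coe_subset.2 ((filter_subset _ _).trans hI))

theorem exch_exch {s : Finset ℕ} {i j : ℕ} (hi : i ∈ s) (hj : j ∉ s) :
    exch (exch s i j) j i = s := by
  unfold exch
  rw [erase_insert (fun h => hj (mem_of_mem_erase h)), insert_erase hi]

/-- The injection exchanges i for j when j is missing and fixes the other sets; exchanged sets lack
i, fixed ones contain it. -/
theorem card_filter_mem_le {I : Finset (Finset ℕ)} {i j : ℕ}
    (h : ∀ s ∈ I, i ∈ s → j ∉ s → exch s i j ∈ I) :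
    #{s ∈ I | i ∈ s} ≤ #{s ∈ I | j ∈ s} := by
  refine card_le_card_of_injOn (fun s => if j ∈ s then s else exch s i j) ?_ ?_
  · intro s hs
    have hs := mem_filter.1 hs
    simp only
    split_ifs with hj
    · exact mem_filter.2 ⟨hs.1, hj⟩
    · exact mem_filter.2 ⟨h s hs.1 hs.2 hj, mem_insert_self _ _⟩
  · intro s hs t ht hst
    have hs := (mem_filter.1 hs).2
    have ht := (mem_filter.1 ht).2
    have hno : ∀ u : Finset ℕ, i ∈ u → j ∉ u → i ∉ exch u i j := by
      intro u hi hj h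
      rcases mem_insert.1 h with rfl | h
      · exact hj hi
      · exact notMem_erase _ _ h
    simp only at hst
    split_ifs at hst with h1 h2 h2
    · exact hst
    · exact absurd (hst ▸ hs) (hno t ht h2)
    · exact absurd (hst ▸ ht) (hno s hs h1)
    · rw [← exch_exch hs h1, ← exch_exch ht h2, hst]

/-- Lowering exchanges make the derivative dimension weakly decreasing in the index, so the last one
is minimal; the raise closure makes the one before it minimal too. -/
theorem two_le_symmetry {n : ℕ} {I : Finset ℕ} (hI : I ⊆ range (2 ^ (n + 2)))
    (h : Closed (n + 2) Set.univ (fam (n + 2) I)) (hr : RaiseClosed (fam (n + 2) I) n) :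
    2 ≤ symmetry (n + 2) I := by
  have hlow : ∀ i j : Fin (n + 2), j ≤ i → derivDim (n + 2) I i ≤ derivDim (n + 2) I j := by
    intro i j hij
    rw [derivDim_eq hI, derivDim_eq hI]
    refine card_filter_mem_le fun s hs hi hj => h.exch_mem (fam_subset _ _) hs hi hj ?_
    exact lt_of_le_of_ne (Fin.le_def.1 hij) (by rintro h; exact hj (h ▸ hi))
  have hraise : derivDim (n + 2) I ⟨n, by omega⟩ ≤ derivDim (n + 2) I ⟨n + 1, by omega⟩ := by
    rw [derivDim_eq hI, derivDim_eq hI]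
    exact card_filter_mem_le hr
  have hlast : ∀ j, derivDim (n + 2) I ⟨n + 1, by omega⟩ ≤ derivDim (n + 2) I j :=
    fun j => hlow _ j (Fin.le_def.2 (Nat.lt_succ_iff.1 j.2))
  have hne : (⟨n, by omega⟩ : Fin (n + 2)) ≠ ⟨n + 1, by omega⟩ := by
    simp [Fin.ext_iff]
  refine (card_pair hne).symm.trans_le (card_le_card fun i hi => ?_)
  simp only [mem_filter, mem_univ, true_and]
  rcases mem_insert.1 hi with rfl | hi
  · exact fun j => hraise.trans (hlast j)
  · rw [mem_singleton.1 hi]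
    exact hlast

/-! ### Monomial functions and the codes that they span -/

/-- The negative monomial with the set of variables `s`. -/
def mono (n : ℕ) (s : Finset ℕ) (z : Fin n → ZMod 2) : ZMod 2 :=
  ∏ i : Fin n, if (i : ℕ) ∈ s then 1 + z i else 1

theorem mono_empty (n : ℕ) : mono n ∅ = 1 := by
  ext z; simp [mono]

theorem mono_mul (n : ℕ) (s t : Finset ℕ) : mono n s * mono n t = mono n (s ∪ t) := by
  ext z
  simp only [mono, Pi.mul_apply, ← prod_mul_distrib]
  refine prod_congr rfl fun i _ => ?_
  have h : ∀ a : ZMod 2, (1 + a) * (1 + a) = 1 + a := by decide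
  by_cases hs : (i : ℕ) ∈ s <;> by_cases ht : (i : ℕ) ∈ t <;> simp [hs, ht, h]

theorem mono_singleton {n : ℕ} (i : Fin n) (z : Fin n → ZMod 2) :
    mono n {(i : ℕ)} z = 1 + z i := by
  simp [mono, Fin.val_inj]

theorem mono_insert {n : ℕ} (i : Fin n) (s : Finset ℕ) (z : Fin n → ZMod 2) :
    mono n (insert (i : ℕ) s) z = (1 + z i) * mono n s z := by
  rw [insert_eq, ← mono_mul, Pi.mul_apply, mono_singleton]

theorem monomial_eq_mono (n l : ℕ) : monomial n l = mono n (nvars n l) := by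
  ext z
  simp only [monomial, vars, mono, prod_filter, mem_nvars, Fin.is_lt, true_and]

/-- The span of the monomials in `I`. -/
def code (n : ℕ) (I : Finset (Finset ℕ)) : Submodule (ZMod 2) ((Fin n → ZMod 2) → ZMod 2) :=
  Submodule.span (ZMod 2) (mono n '' I)

theorem mono_mem_code {n : ℕ} {I : Finset (Finset ℕ)} {s : Finset ℕ} (hs : s ∈ I) :
    mono n s ∈ code n I :=
  Submodule.subset_span ⟨s, hs, rfl⟩

theorem transform_eq_mono (n : ℕ) (l : Fin (2 ^ n)) :
    transform n l = mono n (nvars n l) ∘ bitsEquiv n := by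
  ext k
  rw [transform_apply, monomial_eq_mono]
  rfl

theorem comp_bitsEquiv_mem {n : ℕ} {I : Finset ℕ} (hI : I ⊆ range (2 ^ n))
    {f : (Fin n → ZMod 2) → ZMod 2} :
    f ∘ bitsEquiv n ∈ polarCode n I ↔ f ∈ code n (fam n I) := by
  constructor
  · rintro ⟨u, hu, h⟩
    have hf : f = ∑ i, u i • mono n (nvars n i) := by
      funext z
      have := congrFun h ((bitsEquiv n).symm z)
      rw [Function.comp_apply, Equiv.apply_symm_apply] at this
      rw [this, Matrix.vecMul, dotProduct, Finset.sum_apply]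
      refine sum_congr rfl fun i _ => ?_
      rw [transform_eq_mono]
      simp
    rw [hf]
    refine Submodule.sum_mem _ fun i _ => ?_
    by_cases hi : (i : ℕ) ∈ I
    · exact Submodule.smul_mem _ _ (mono_mem_code (mem_image_of_mem _ hi))
    · rw [hu i hi, zero_smul]
      exact Submodule.zero_mem _
  · intro hf
    have : code n (fam n I) ≤
        (polarCode n I).comap (LinearMap.funLeft (ZMod 2) (ZMod 2) (bitsEquiv n)) := by
      refine Submodule.span_le.2 ?_
      rintro _ ⟨s, hs, rfl⟩
      obtain ⟨l, hl, rfl⟩ := mem_image.1 (mem_coe.1 hs)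
      have hl' := mem_range.1 (hI hl)
      refine ⟨Pi.single ⟨l, hl'⟩ 1, fun i hi => Pi.single_eq_of_ne ?_ _, ?_⟩
      · rintro rfl; exact hi hl
      · rw [Matrix.single_one_vecMul, Matrix.row, transform_eq_mono]
        rfl
    exact this hf

theorem mem_polarCode {n : ℕ} {I : Finset ℕ} (hI : I ⊆ range (2 ^ n)) {x : Fin (2 ^ n) → ZMod 2} :
    x ∈ polarCode n I ↔ x ∘ (bitsEquiv n).symm ∈ code n (fam n I) := by
  rw [← comp_bitsEquiv_mem hI, Function.comp_assoc, Equiv.symm_comp_self, Function.comp_id]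

/-! ### Maps that preserve a code -/

/-- Composition with `g` preserves the span of the monomials in `I`. -/
def Pres {n : ℕ} (I : Finset (Finset ℕ)) (g : (Fin n → ZMod 2) → Fin n → ZMod 2) : Prop :=
  ∀ f ∈ code n I, f ∘ g ∈ code n I

theorem Pres.comp {n : ℕ} {I : Finset (Finset ℕ)} {g h : (Fin n → ZMod 2) → Fin n → ZMod 2}
    (hg : Pres I g) (hh : Pres I h) : Pres I (g ∘ h) := fun f hf => hh _ (hg f hf)

theorem pres_of_mono {n : ℕ} {I : Finset (Finset ℕ)} {g : (Fin n → ZMod 2) → Fin n → ZMod 2}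
    (h : ∀ s ∈ I, mono n s ∘ g ∈ code n I) : Pres I g := by
  have : code n I ≤ (code n I).comap (LinearMap.funLeft (ZMod 2) (ZMod 2) g) := by
    refine Submodule.span_le.2 ?_
    rintro _ ⟨s, hs, rfl⟩
    exact h s hs
  exact fun f hf => this hf

theorem mem_affineAut {n : ℕ} {I : Finset ℕ} (hI : I ⊆ range (2 ^ n)) {g : GA n} :
    g ∈ affineAut (polarCode n I) ↔ Pres (fam n I) g.symm := by
  have key : ∀ f : (Fin n → ZMod 2) → ZMod 2,
      (f ∘ bitsEquiv n) ∘ (affinePerm n g).symm = (f ∘ g.symm) ∘ bitsEquiv n := by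
    intro f
    funext k
    simp [affinePerm]
  constructor
  · intro h f hf
    have := h _ ((comp_bitsEquiv_mem hI).2 hf)
    rwa [key, comp_bitsEquiv_mem hI] at this
  · intro h x hx
    have := (comp_bitsEquiv_mem hI).2 (h _ ((mem_polarCode hI).1 hx))
    rwa [← key, Function.comp_assoc x, Equiv.symm_comp_self, Function.comp_id] at this

/-- The permuted word involves the inverse of g, which is harmless in a group. -/
theorem mem_affineAut' {n : ℕ} {I : Finset ℕ} (hI : I ⊆ range (2 ^ n)) {g : GA n} :
    g ∈ affineAut (polarCode n I) ↔ Pres (fam n I) g := by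
  rw [← inv_mem_iff, mem_affineAut hI]
  rfl

/-- A factor with index i turns into a constant plus factors with indices j for which M i j ≠ 0, so
no threshold of T is crossed upwards. Multiplying out only takes unions, since the factors are
idempotent. -/
theorem mono_comp_affine_mem {n : ℕ} {T : Set ℕ} (M : Matrix (Fin n) (Fin n) (ZMod 2))
    (b : Fin n → ZMod 2) (hM : ∀ i j : Fin n, ∀ k ∈ T, (i : ℕ) < k → k ≤ j → M i j = 0)
    {t : Finset ℕ} (ht : t ⊆ range n) :
    (mono n t ∘ fun z => M.mulVec z + b) ∈ Submodule.span (ZMod 2)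
      (mono n '' {s | s ⊆ range n ∧ ∀ k ∈ T, cnt s k ≤ cnt t k}) := by
  induction t using Finset.induction_on with
  | empty =>
    rw [mono_empty]
    exact Submodule.subset_span ⟨∅, ⟨empty_subset _, fun k _ => le_rfl⟩, mono_empty n⟩
  | insert i t hi ih =>
    have hin : i < n := mem_range.1 (ht (mem_insert_self i t))
    have ih := ih ((subset_insert i t).trans ht)
    set g : (Fin n → ZMod 2) → Fin n → ZMod 2 := fun z => M.mulVec z + b with hg
    have hmul : mono n (insert i t) ∘ g = (mono n {i} ∘ g) * (mono n t ∘ g) := by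
      rw [insert_eq, ← mono_mul]
      rfl
    have hlin : mono n {i} ∘ g ∈ Submodule.span (ZMod 2)
        (mono n '' {s | s ⊆ range n ∧ ∃ j, s ⊆ {j} ∧ ∀ k ∈ T, k ≤ j → k ≤ i}) := by
      -- Rewriting z j as 1 + (1 + z j) moves the row sum of M into the constant.
      have heq : mono n {i} ∘ g = (1 + b ⟨i, hin⟩ + ∑ j, M ⟨i, hin⟩ j) • mono n ∅ +
          ∑ j, M ⟨i, hin⟩ j • mono n {(j : ℕ)} := by
        funext z
        have h1 : mono n {i} (g z) = 1 + g z ⟨i, hin⟩ := mono_singleton ⟨i, hin⟩ (g z)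
        have h2 : ∀ a : ZMod 2, a + a = 0 := by decide
        have h3 := h2 (∑ j, M ⟨i, hin⟩ j)
        rw [Function.comp_apply, h1]
        simp only [hg, Pi.add_apply, Matrix.mulVec, dotProduct, mono_empty,
          Pi.smul_apply, Pi.one_apply, smul_eq_mul, mul_one, Finset.sum_apply, mono_singleton,
          mul_add, sum_add_distrib]
        linear_combination -h3
      rw [heq]
      refine Submodule.add_mem _ (Submodule.smul_mem _ _ (Submodule.subset_span ?_))
        (Submodule.sum_mem _ fun j _ => ?_)
      · exact ⟨∅, ⟨empty_subset _, i, empty_subset _, fun k _ h => h⟩, rfl⟩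
      · by_cases hj : M ⟨i, hin⟩ j = 0
        · rw [hj, zero_smul]
          exact Submodule.zero_mem _
        · refine Submodule.smul_mem _ _
            (Submodule.subset_span ⟨{(j : ℕ)}, ⟨?_, j, Subset.rfl, ?_⟩, rfl⟩)
          · simp
          · intro k hk hkj
            by_contra hki
            exact hj (hM _ _ k hk (not_le.1 hki) hkj)
    rw [hmul]
    have h := Submodule.mul_mem_mul hlin ih
    rw [Submodule.span_mul_span] at h
    refine Submodule.span_mono ?_ h
    rintro _ ⟨_, ⟨s, ⟨hs, j, hsj, hjT⟩, rfl⟩, _, ⟨s', ⟨hs', hc⟩, rfl⟩, rfl⟩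
    refine ⟨s ∪ s', ⟨union_subset hs hs', fun k hk => ?_⟩, (mono_mul n s s').symm⟩
    have h1 : cnt (s ∪ s') k ≤ cnt (insert j s') k :=
      cnt_mono (by rw [insert_eq]; exact union_subset_union_left hsj) k
    have h2 := cnt_insert_le s' j k
    have h3 := cnt_insert hi k
    have h4 := hc k hk
    have h5 := hjT k hk
    split_ifs at h2 h3 <;> omega

/-- Affine maps whose matrix is block lower triangular preserve closed families. -/
theorem Closed.pres {n : ℕ} {T : Set ℕ} {I : Finset (Finset ℕ)} (h : Closed n T I)
    (hI : I ⊆ (range n).powerset) (M : Matrix (Fin n) (Fin n) (ZMod 2)) (b : Fin n → ZMod 2)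
    (hM : ∀ i j : Fin n, ∀ k ∈ T, (i : ℕ) < k → k ≤ j → M i j = 0) :
    Pres I fun z => M.mulVec z + b := by
  refine pres_of_mono fun t ht => ?_
  refine Submodule.span_mono ?_ (mono_comp_affine_mem M b hM (mem_powerset.1 (hI ht)))
  exact Set.image_mono fun s hs => h t ht s hs.1 hs.2

/-! ### Coefficients -/

/-- The point at which the variables in `u` have the negation `1` and the others have `0`. -/
def point (n : ℕ) (u : Finset ℕ) : Fin n → ZMod 2 := fun i => if (i : ℕ) ∈ u then 0 else 1

theorem mono_point {n : ℕ} {s : Finset ℕ} (hs : s ⊆ range n) (u : Finset ℕ) :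
    mono n s (point n u) = if s ⊆ u then 1 else 0 := by
  have h2 : (1 : ZMod 2) + 1 = 0 := by decide
  split_ifs with h
  · refine prod_eq_one fun i _ => ?_
    split_ifs with hi
    · simp [point, h hi]
    · rfl
  · obtain ⟨i, hi, hu⟩ := not_subset.1 h
    refine prod_eq_zero (mem_univ ⟨i, mem_range.1 (hs hi)⟩) ?_
    simp [point, hi, hu, h2]

/-- The coefficient of the monomial `t`. -/
def coeff (n : ℕ) (t : Finset ℕ) : ((Fin n → ZMod 2) → ZMod 2) →ₗ[ZMod 2] ZMod 2 :=
  ∑ u ∈ t.powerset, LinearMap.proj (point n u)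

/-- Möbius inversion modulo 2: the sum counts the sets between s and t, and their number is 0 or a
power of two, odd only for s = t. -/
theorem coeff_mono {n : ℕ} {s t : Finset ℕ} (hs : s ⊆ range n) :
    coeff n t (mono n s) = if s = t then 1 else 0 := by
  have h1 : coeff n t (mono n s) = (#(Icc s t) : ZMod 2) := by
    simp only [coeff, LinearMap.sum_apply, LinearMap.proj_apply, mono_point hs]
    rw [sum_boole, Icc_eq_filter_powerset]
  rw [h1]
  split_ifs with h
  · simp [h]
  · by_cases hst : s ⊆ t
    · have hlt := card_lt_card (hst.ssubset_of_ne h)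
      rw [card_Icc_finset hst, Nat.cast_pow, show ((2 : ℕ) : ZMod 2) = 0 from rfl, zero_pow]
      omega
    · rw [Icc_eq_empty hst, card_empty, Nat.cast_zero]

theorem mem_of_mono_mem_code {n : ℕ} {I : Finset (Finset ℕ)} (hI : I ⊆ (range n).powerset)
    {t : Finset ℕ} (ht : t ⊆ range n) (h : mono n t ∈ code n I) : t ∈ I := by
  by_contra hn
  have : code n I ≤ LinearMap.ker (coeff n t) := by
    refine Submodule.span_le.2 ?_
    rintro _ ⟨s, hs, rfl⟩
    rw [SetLike.mem_coe, LinearMap.mem_ker, coeff_mono (mem_powerset.1 (hI hs)), if_neg]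
    rintro rfl
    exact hn hs
  have h0 := this h
  rw [LinearMap.mem_ker, coeff_mono ht, if_pos rfl] at h0
  exact one_ne_zero h0

/-! ### Transvections -/

/-- The map `z ↦ z + φ(z) u`. -/
def transv {n : ℕ} (u φ : Fin n → ZMod 2) (z : Fin n → ZMod 2) : Fin n → ZMod 2 :=
  z + (φ ⬝ᵥ z) • u

/-- The map that adds the variable `q` to the variable `p`. -/
def elemTransv {n : ℕ} (p q : Fin n) : (Fin n → ZMod 2) → Fin n → ZMod 2 :=
  transv (Pi.single p 1) (Pi.single q 1)

theorem elemTransv_apply {n : ℕ} (p q : Fin n) (z : Fin n → ZMod 2) (i : Fin n) :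
    elemTransv p q z i = z i + if i = p then z q else 0 := by
  simp [elemTransv, transv, Pi.single_apply]

theorem Closed.pres_transv {n : ℕ} {T : Set ℕ} {I : Finset (Finset ℕ)} (h : Closed n T I)
    (hI : I ⊆ (range n).powerset) {u φ : Fin n → ZMod 2}
    (hu : ∀ i j : Fin n, ∀ k ∈ T, (i : ℕ) < k → k ≤ j → u i * φ j = 0) :
    Pres I (transv u φ) := by
  have := h.pres hI (1 + Matrix.vecMulVec u φ) 0 fun i j k hk hik hkj => by
    have hij : i ≠ j := by rintro rfl; omega
    rw [Matrix.add_apply, Matrix.one_apply_ne hij, zero_add, Matrix.vecMulVec_apply,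
      hu i j k hk hik hkj]
  refine (congrArg (Pres I) (funext fun z => ?_)).mp this
  rw [add_zero, Matrix.add_mulVec, Matrix.one_mulVec, Matrix.vecMulVec_mulVec]
  simp [transv]

/-- If the code is preserved by adding the variable `q` to the variable `p`, then its family is
closed under exchange of `p` for `q`. -/
theorem exch_mem_of_pres {n : ℕ} {I : Finset (Finset ℕ)} (hI : I ⊆ (range n).powerset)
    (h : Closed n Set.univ I) {p q : Fin n} (hp : Pres I (elemTransv p q)) {t : Finset ℕ}
    (ht : t ∈ I) (hpt : (p : ℕ) ∈ t) : exch t p q ∈ I := by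
  have htn := mem_powerset.1 (hI ht)
  have he : t.erase p ∈ I := h.subset_mem hI ht (erase_subset _ _)
  -- From 1 + z p + z q = (1 + z p) + (1 + z q) + 1. If q ∈ t, the last two monomials coincide and
  -- cancel.
  have heq : mono n t ∘ elemTransv p q =
      mono n t + mono n (exch t p q) + mono n (t.erase p) := by
    funext z
    have h1 : mono n (t.erase p) (elemTransv p q z) = mono n (t.erase p) z := by
      refine prod_congr rfl fun i _ => ?_
      by_cases hi : i = p
      · simp [hi]
      · rw [elemTransv_apply, if_neg hi, add_zero]
    have h2 : mono n t = mono n (insert (p : ℕ) (t.erase p)) := by rw [insert_erase hpt]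
    have h3 : ∀ a : ZMod 2, a + a = 0 := by decide
    simp only [Function.comp_apply, Pi.add_apply]
    rw [h2, mono_insert, h1, elemTransv_apply, if_pos rfl, exch, mono_insert, mono_insert]
    linear_combination - h3 (mono n (t.erase p) z)
  have hm := hp _ (mono_mem_code ht)
  rw [heq] at hm
  have h1 := (Submodule.add_mem_iff_left _ (mono_mem_code he)).1 hm
  have h2 := (Submodule.add_mem_iff_right _ (mono_mem_code ht)).1 h1
  refine mem_of_mono_mem_code hI (insert_subset ?_ ((erase_subset _ _).trans htn)) h2
  simp

theorem zmod_two_add_self (a : ZMod 2) : a + a = 0 := CharTwo.add_self_eq_zero a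

theorem Pres.transv_add_left {n : ℕ} {I : Finset (Finset ℕ)} {u u' φ : Fin n → ZMod 2}
    (h : Pres I (transv u φ)) (h' : Pres I (transv u' φ)) (h0 : φ ⬝ᵥ u' = 0) :
    Pres I (transv (u + u') φ) := by
  refine (congrArg (Pres I) (funext fun z => ?_)).mp (h.comp h')
  simp only [Function.comp_apply, transv, dotProduct_add, dotProduct_smul, h0, smul_zero, add_zero,
    smul_add]
  abel

theorem Pres.transv_add_right {n : ℕ} {I : Finset (Finset ℕ)} {u φ φ' : Fin n → ZMod 2}
    (h : Pres I (transv u φ)) (h' : Pres I (transv u φ')) (h0 : φ ⬝ᵥ u = 0) :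
    Pres I (transv u (φ + φ')) := by
  refine (congrArg (Pres I) (funext fun z => ?_)).mp (h.comp h')
  simp only [Function.comp_apply, transv, dotProduct_add, dotProduct_smul, h0, smul_zero, add_zero,
    add_dotProduct, add_smul]
  abel

/-- The hypothesis on ψ and v makes the second transvection τ an involution; conjugation by it
replaces u by τ u and φ by φ ∘ τ. -/
theorem Pres.transv_conj {n : ℕ} {I : Finset (Finset ℕ)} {u φ v ψ : Fin n → ZMod 2}
    (h : Pres I (transv u φ)) (h' : Pres I (transv v ψ)) (h0 : ψ ⬝ᵥ v = 0) :
    Pres I (transv (u + (ψ ⬝ᵥ u) • v) (φ + (φ ⬝ᵥ v) • ψ)) := by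
  refine (congrArg (Pres I) (funext fun z => ?_)).mp ((h'.comp h).comp h')
  funext i
  simp only [Function.comp_apply, transv, dotProduct_add, dotProduct_smul, h0,
    add_dotProduct, smul_dotProduct, Pi.add_apply, Pi.smul_apply, smul_eq_mul]
  linear_combination zmod_two_add_self (ψ ⬝ᵥ z * v i)

/-- A transvection that preserves a decreasing code yields an elementary one. -/
theorem Closed.pres_elemTransv_of_transv {n : ℕ} {I : Finset (Finset ℕ)}
    (h : Closed n Set.univ I) (hI : I ⊆ (range n).powerset) {u φ : Fin n → ZMod 2}
    (hp : Pres I (transv u φ)) (h0 : φ ⬝ᵥ u = 0) {p q : Fin n} (hpq : p < q)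
    (hup : u p = 1) (hu : ∀ r < p, u r = 0) (hφq : φ q = 1) (hφ : ∀ r, q < r → φ r = 0) :
    Pres I (elemTransv p q) := by
  have hlow : ∀ v ψ : Fin n → ZMod 2, (∀ i j, i < j → v i * ψ j = 0) → Pres I (transv v ψ) :=
    fun v ψ hv => h.pres_transv hI fun i j k _ hik hkj => hv i j (Fin.lt_def.2 (by omega))
  -- The lower triangular map z ↦ z + z p • v sends u to the p-th unit vector.
  set v : Fin n → ZMod 2 := u + Pi.single p 1 with hv
  have hvp : v p = 0 := by simp [hv, hup, zmod_two_add_self]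
  have hv0 : ∀ i < p, v i = 0 := fun i hi => by simp [hv, hu i hi, hi.ne]
  have h1 := hp.transv_conj (hlow v (Pi.single p 1) fun i j hij => by
    by_cases hj : j = p
    · rw [hv0 i (hj ▸ hij), zero_mul]
    · rw [Pi.single_eq_of_ne hj, mul_zero]) (by simp [hvp])
  have hu1 : u + (Pi.single p 1 ⬝ᵥ u) • v = Pi.single p 1 := by
    funext i
    simp only [single_one_dotProduct, hup, one_smul, hv, Pi.add_apply]
    linear_combination zmod_two_add_self (u i)
  rw [hu1] at h1
  set φ' : Fin n → ZMod 2 := φ + (φ ⬝ᵥ v) • Pi.single p 1 with hφ'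
  have hφ'p : φ' p = 0 := by
    simp [hφ', hv, dotProduct_add, h0, zmod_two_add_self]
  have hφ'q : φ' q = 1 := by simp [hφ', hφq, hpq.ne']
  have hφ'r : ∀ r, q < r → φ' r = 0 := fun r hr => by simp [hφ', hφ r hr, (hpq.trans hr).ne']
  -- Likewise, conjugation by z ↦ z + w(z) e_q turns φ' into the q-th coordinate; it fixes e_p
  -- because φ' p = φ ⬝ᵥ u = 0.
  set w : Fin n → ZMod 2 := φ' + Pi.single q 1 with hw
  have hwq : w q = 0 := by simp [hw, hφ'q, zmod_two_add_self]
  have hwp : w p = 0 := by simp [hw, hφ'p, hpq.ne]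
  have hw0 : ∀ r, q < r → w r = 0 := fun r hr => by simp [hw, hφ'r r hr, hr.ne']
  have h2 := h1.transv_conj (hlow (Pi.single q 1) w fun i j hij => by
    by_cases hi : i = q
    · rw [hw0 j (hi ▸ hij), mul_zero]
    · rw [Pi.single_eq_of_ne hi, zero_mul]) (by simp [hwq])
  have hφ2 : φ' + (φ' ⬝ᵥ Pi.single q 1) • w = Pi.single q 1 := by
    funext i
    simp only [dotProduct_single_one, hφ'q, one_smul, hw, Pi.add_apply]
    linear_combination zmod_two_add_self (φ' i)
  rw [hφ2, dotProduct_single_one, hwp, zero_smul, add_zero] at h2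
  exact h2

/-- Conjugation by a lower triangular elementary map adds the p'-th unit vector to the p-th, and
composition with the original map cancels the latter. The index q is moved down to q' in the same
way. -/
theorem Closed.pres_elemTransv_mono {n : ℕ} {I : Finset (Finset ℕ)}
    (h : Closed n Set.univ I) (hI : I ⊆ (range n).powerset) {p p' q q' : Fin n}
    (hp : Pres I (elemTransv p q)) (hpp' : p ≤ p') (hp'q' : p' < q') (hqq' : q' ≤ q) :
    Pres I (elemTransv p' q') := by
  have hlow : ∀ i j : Fin n, j < i → Pres I (elemTransv i j) := fun i j hij =>
    h.pres_transv hI fun a b k _ hak hkb => by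
      by_cases ha : a = i
      · have hb : b ≠ j := by
          rintro rfl
          subst ha
          exact absurd (Fin.lt_def.1 hij) (by omega)
        rw [Pi.single_eq_of_ne hb, mul_zero]
      · rw [Pi.single_eq_of_ne ha, zero_mul]
  have h1 : Pres I (elemTransv p' q) := by
    rcases hpp'.eq_or_lt with rfl | hlt
    · exact hp
    have hpq : p ≠ q := (hlt.trans (hp'q'.trans_le hqq')).ne
    have hp'q : p' ≠ q := (hp'q'.trans_le hqq').ne
    have h1 := (hp.transv_conj (hlow p' p hlt) (by simp [hlt.ne])).transv_add_left
      (u' := Pi.single p 1) (by simpa [elemTransv, hp'q] using hp) (by simp [hpq, hp'q])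
    refine (congrArg (Pres I) ?_).mp h1
    unfold elemTransv
    congr 1
    · funext i
      simp only [dotProduct_single_one, Pi.single_eq_same, one_smul, Pi.add_apply]
      linear_combination zmod_two_add_self ((Pi.single p 1 : Fin n → ZMod 2) i)
    · simp [hp'q]
  rcases hqq'.eq_or_lt with rfl | hlt
  · exact h1
  have hp'q : p' ≠ q := (hp'q'.trans hlt).ne
  have h2 := (h1.transv_conj (hlow q q' hlt) (by simp [hlt.ne])).transv_add_right
    (φ' := Pi.single q 1) (by simpa [elemTransv, hp'q'.ne, hp'q'.ne'] using h1)
    (by simp [hp'q, hp'q'.ne])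
  refine (congrArg (Pres I) ?_).mp h2
  unfold elemTransv
  congr 1
  · simp [hp'q'.ne']
  · funext i
    simp only [dotProduct_single_one, Pi.single_eq_same, one_smul, Pi.add_apply]
    linear_combination zmod_two_add_self ((Pi.single q 1 : Fin n → ZMod 2) i)

theorem toMatrix'_symm_eq_zero {n : ℕ} (a : (Fin n → ZMod 2) ≃ₗ[ZMod 2] (Fin n → ZMod 2)) {k : ℕ}
    (h : ∀ i j : Fin n, (i : ℕ) ≤ k → k < j → LinearMap.toMatrix' a.toLinearMap i j = 0)
    (i j : Fin n)
    (hi : (i : ℕ) ≤ k) (hj : k < j) : LinearMap.toMatrix' a.symm.toLinearMap i j = 0 := by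
  have h1 : LinearMap.toMatrix' a.symm.toLinearMap * LinearMap.toMatrix' a.toLinearMap = 1 := by
    rw [← LinearMap.toMatrix'_comp, ← LinearMap.toMatrix'_id]
    congr 1
    ext1 i
    simp
  let b : Fin n → ℕᵒᵈ := fun i => OrderDual.toDual (if (i : ℕ) ≤ k then 0 else 1)
  let : Invertible (LinearMap.toMatrix' a.toLinearMap) := invertibleOfLeftInverse _ _ h1
  have hlt : ∀ i j : Fin n, b j < b i ↔ (i : ℕ) ≤ k ∧ k < j := by
    intro i j
    simp only [b, OrderDual.toDual_lt_toDual]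
    split_ifs <;> omega
  have h2 := Matrix.blockTriangular_inv_of_blockTriangular (b := b)
    (M := LinearMap.toMatrix' a.toLinearMap)
    fun i j hij => h i j ((hlt i j).1 hij).1 ((hlt i j).1 hij).2
  rw [Matrix.inv_eq_left_inv h1] at h2
  exact h2 ((hlt i j).2 ⟨hi, hj⟩)

/-- If a linear automorphism of a decreasing code is not block lower triangular at the threshold
`k + 1`, then adding the variable `k + 1` to the variable `k` preserves the code. -/
theorem Closed.pres_elemTransv {n : ℕ} {I : Finset (Finset ℕ)}
    (h : Closed n Set.univ I) (hI : I ⊆ (range n).powerset)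
    (a : (Fin n → ZMod 2) ≃ₗ[ZMod 2] (Fin n → ZMod 2)) (ha : Pres I a) (ha' : Pres I a.symm)
    {k : ℕ} (hk : k + 1 < n) {i j : Fin n} (hi : (i : ℕ) ≤ k) (hj : k < j)
    (hij : LinearMap.toMatrix' a.toLinearMap i j ≠ 0) :
    Pres I (elemTransv ⟨k, by omega⟩ ⟨k + 1, hk⟩) := by
  have hone : ∀ x : ZMod 2, x ≠ 0 → x = 1 := by decide
  -- The inverse of a block lower triangular matrix is block lower triangular, so the inverse of a
  -- also has a nonzero entry across the threshold.
  obtain ⟨r, s, hr, hs, hrs⟩ : ∃ r s : Fin n, (r : ℕ) ≤ k ∧ k < s ∧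
      LinearMap.toMatrix' a.symm.toLinearMap r s ≠ 0 := by
    by_contra! hno
    exact hij (toMatrix'_symm_eq_zero a.symm (fun r s hr hs => hno r s hr hs) i j hi hj)
  set u : Fin n → ZMod 2 := a (Pi.single j 1) with hu
  set φ : Fin n → ZMod 2 := LinearMap.toMatrix' a.symm.toLinearMap r with hφ
  have hφz : ∀ z, φ ⬝ᵥ z = a.symm z r := fun z => by
    have := congrFun (LinearMap.toMatrix'_mulVec a.symm.toLinearMap z) r
    exact this
  have hui : u i ≠ 0 := by
    rw [LinearMap.toMatrix'_apply] at hij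
    exact hij
  have hlow : Pres I (elemTransv j r) := h.pres_transv hI fun x y l _ hxl hly => by
    by_cases hx : x = j
    · have hy : y ≠ r := by
        rintro rfl
        subst hx
        omega
      rw [Pi.single_eq_of_ne hy, mul_zero]
    · rw [Pi.single_eq_of_ne hx, zero_mul]
  -- The conjugate by a of the lower triangular map adding variable r to variable j. The first
  -- support index of u is at most k, the last one of φ is above k.
  have htr : Pres I (transv u φ) := by
    refine (congrArg (Pres I) (funext fun z => ?_)).mp ((ha.comp hlow).comp ha')
    simp [elemTransv, transv, hφz, hu]
  have hrj : r ≠ j := by rintro rfl; omega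
  have h0 : φ ⬝ᵥ u = 0 := by simp [hφz, hu, hrj]
  have hA : ({x | u x ≠ 0} : Finset (Fin n)).Nonempty := ⟨i, by simpa using hui⟩
  have hB : ({x | φ x ≠ 0} : Finset (Fin n)).Nonempty := ⟨s, by simpa using hrs⟩
  have hp := (mem_filter.1 (min'_mem _ hA)).2
  have hq := (mem_filter.1 (max'_mem _ hB)).2
  have hpi := min'_le ({x | u x ≠ 0} : Finset (Fin n)) i (mem_filter.2 ⟨mem_univ i, hui⟩)
  have hqs := le_max' ({x | φ x ≠ 0} : Finset (Fin n)) s (mem_filter.2 ⟨mem_univ s, hrs⟩)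
  have hpmin : ∀ x < min' _ hA, u x = 0 := fun x hx => by
    by_contra hne
    exact (min'_le _ x (mem_filter.2 ⟨mem_univ x, hne⟩)).not_gt hx
  have hqmax : ∀ x, max' _ hB < x → φ x = 0 := fun x hx => by
    by_contra hne
    exact (le_max' _ x (mem_filter.2 ⟨mem_univ x, hne⟩)).not_gt hx
  set p := min' _ hA
  set q := max' _ hB
  rw [Fin.le_def] at hpi hqs
  have hpq : Pres I (elemTransv p q) :=
    h.pres_elemTransv_of_transv hI htr h0 (Fin.lt_def.2 (by omega)) (hone _ hp) hpmin (hone _ hq)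
      hqmax
  refine h.pres_elemTransv_mono hI hpq (Fin.le_def.2 ?_) (Fin.lt_def.2 ?_) (Fin.le_def.2 ?_) <;>
    simp only <;> omega

/-! ### Block structure -/

/-- The first indices of the blocks of a composition. -/
def blockStarts {n : ℕ} (S : Composition n) : Set ℕ := {k | ∃ m < S.length, k = S.sizeUpTo m}

theorem index_lt_index_iff {n : ℕ} (S : Composition n) (i j : Fin n) :
    S.index i < S.index j ↔ ∃ k ∈ blockStarts S, (i : ℕ) < k ∧ k ≤ j := by
  constructor
  · intro h
    refine ⟨_, ⟨S.index j, (S.index j).2, rfl⟩, ?_, S.sizeUpTo_index_le j⟩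
    exact (S.lt_sizeUpTo_index_succ i).trans_le (S.monotone_sizeUpTo (Nat.succ_le_of_lt h))
  · rintro ⟨_, ⟨m, -, rfl⟩, hi, hj⟩
    by_contra! hle
    have h1 : m < (S.index j : ℕ) + 1 := by
      by_contra! h
      have h2 := S.lt_sizeUpTo_index_succ j
      have h3 := S.monotone_sizeUpTo h
      simp only [Fin.val_succ] at h2
      omega
    have h2 := S.monotone_sizeUpTo (show m ≤ (S.index i : ℕ) from by
      have := Fin.le_def.1 hle
      omega)
    have h3 := S.sizeUpTo_index_le i
    omega

theorem zero_mem_blockStarts {n : ℕ} (hn : 0 < n) (S : Composition n) : 0 ∈ blockStarts S :=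
  ⟨0, S.length_pos_of_pos hn, S.sizeUpTo_zero.symm⟩

/-- Block starts are the partial sums other than the total, so the last block size does not enter.
-/
theorem blockStarts_growLast {n : ℕ} (hn : 0 < n) (S : Composition n) :
    blockStarts (growLast hn S) = blockStarts S := by
  have h : S.blocks ≠ [] := fun h => hn.ne (by simpa [h] using S.blocks_sum)
  have hlen : (growLast hn S).length = S.length := by
    have := List.length_pos_iff.2 h
    simp only [Composition.length, growLast, List.length_append, List.length_dropLast,
      List.length_singleton]
    omega
  have htake : ∀ m < S.length, (growLast hn S).sizeUpTo m = S.sizeUpTo m := by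
    intro m hm
    have hm' : m ≤ S.blocks.dropLast.length := by
      rw [List.length_dropLast]
      exact Nat.le_sub_one_of_lt hm
    have h1 : S.blocks.take m = S.blocks.dropLast.take m := by
      conv_lhs => rw [← List.dropLast_append_getLast h]
      exact List.take_append_of_le_length hm'
    simp only [Composition.sizeUpTo, growLast, h1, List.take_append_of_le_length hm']
  ext k
  simp only [blockStarts, Set.mem_ofPred_eq, hlen]
  exact exists_congr fun m => and_congr_right fun hm => by rw [htake m hm]

theorem mem_BLTA_iff {n : ℕ} {S : Composition n} {g : GA n} :
    g ∈ BLTA S ↔ ∀ i j : Fin n, ∀ k ∈ blockStarts S, (i : ℕ) < k → k ≤ j →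
      LinearMap.toMatrix' (g.linear : (Fin n → ZMod 2) →ₗ[ZMod 2] (Fin n → ZMod 2)) i j = 0 := by
  change (∀ i j : Fin n, S.index i < S.index j → _) ↔ _
  simp only [index_lt_index_iff]
  exact ⟨fun h i j k hk hi hj => h i j ⟨k, hk, hi, hj⟩,
    fun h i j ⟨k, hk, hi, hj⟩ => h i j k hk hi hj⟩

/-! ### Affine automorphisms of decreasing codes -/

theorem affine_apply {n : ℕ} (g : GA n) (z : Fin n → ZMod 2) : g z = g.linear z + g 0 := by
  have := g.map_vadd 0 z
  simpa using this

theorem pres_linear {n : ℕ} {I : Finset (Finset ℕ)} (h : Closed n Set.univ I)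
    (hI : I ⊆ (range n).powerset) {g : GA n} (hg : Pres I g) : Pres I g.linear := by
  have h1 : Pres I fun z : Fin n → ZMod 2 =>
      (1 : Matrix (Fin n) (Fin n) (ZMod 2)).mulVec z + -g 0 :=
    h.pres hI 1 _ fun i j k _ hi hj => Matrix.one_apply_ne (by rintro rfl; omega)
  refine (congrArg (Pres I) (funext fun z => ?_)).mp (h1.comp hg)
  rw [Function.comp_apply, Matrix.one_mulVec, affine_apply g z, add_neg_cancel_right]

theorem Closed.pres_affine {n : ℕ} {T : Set ℕ} {I : Finset (Finset ℕ)} (h : Closed n T I)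
    (hI : I ⊆ (range n).powerset) {g : GA n}
    (hg : ∀ i j : Fin n, ∀ k ∈ T, (i : ℕ) < k → k ≤ j →
      LinearMap.toMatrix' (g.linear : (Fin n → ZMod 2) →ₗ[ZMod 2] (Fin n → ZMod 2)) i j = 0) :
    Pres I g := by
  refine (congrArg (Pres I) (funext fun z => ?_)).mp (h.pres hI _ (g 0) hg)
  rw [LinearMap.toMatrix'_mulVec, affine_apply g z]
  rfl

/-- The affine transformation that adds the variable `q` to the variable `p`. -/
noncomputable def elemGA {n : ℕ} (p q : Fin n) (h : q ≠ p) : GA n :=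
  LinearEquiv.toAffineEquiv
    (LinearEquiv.ofInvolutive
      (LinearMap.id + (LinearMap.single (ZMod 2) (fun _ => ZMod 2) p).comp (LinearMap.proj q))
      fun z => by
        funext i
        by_cases hi : i = p
        · subst hi
          simp [h, add_assoc, zmod_two_add_self]
        · simp [hi])

theorem elemGA_apply {n : ℕ} (p q : Fin n) (h : q ≠ p) : ⇑(elemGA p q h) = elemTransv p q := by
  funext z i
  rw [elemTransv_apply]
  change z i + (Pi.single p (z q) : Fin n → ZMod 2) i = _
  rw [Pi.single_apply]

theorem toMatrix'_elemGA {n : ℕ} (p q : Fin n) (h : q ≠ p) (i j : Fin n) :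
    LinearMap.toMatrix' ((elemGA p q h).linear : (Fin n → ZMod 2) →ₗ[ZMod 2] (Fin n → ZMod 2)) i j =
      (if i = j then 1 else 0) + if i = p ∧ j = q then 1 else 0 := by
  rw [LinearMap.toMatrix'_apply]
  change (Pi.single j 1 : Fin n → ZMod 2) i + (Pi.single p ((Pi.single j 1 : Fin n → ZMod 2) q)
    : Fin n → ZMod 2) i = _
  simp only [Pi.single_apply, eq_comm (a := q), ite_and]

theorem pres_elemTransv_iff_raiseClosed {n : ℕ} {I : Finset (Finset ℕ)} (h : Closed n Set.univ I)
    (hI : I ⊆ (range n).powerset) {k : ℕ} (hk : k + 1 < n) :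
    Pres I (elemTransv ⟨k, by omega⟩ ⟨k + 1, hk⟩) ↔ RaiseClosed I k := by
  constructor
  · exact fun hp t ht hkt _ => exch_mem_of_pres hI h hp ht hkt
  · intro hr
    -- The only off-diagonal entry, at (k, k + 1), crosses the single threshold k + 1, which is the
    -- one left out.
    have hc : Closed n {k + 1}ᶜ I := closed_of_raiseClosed h (by simp) fun l _ hl => by
      have : l = k := by simpa using hl
      exact this ▸ hr
    refine hc.pres_transv hI fun i j l hl hi hj => ?_
    by_cases h1 : i = ⟨k, by omega⟩
    · have h2 : j ≠ ⟨k + 1, hk⟩ := by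
        rintro rfl
        rw [h1] at hi
        simp only [Set.mem_compl_iff, Set.mem_singleton_iff] at hl hi hj
        omega
      rw [Pi.single_eq_of_ne h2, mul_zero]
    · rw [Pi.single_eq_of_ne h1, zero_mul]

/-- If the affine automorphisms of a decreasing code form a block lower triangular group, then those
of the code obtained in one more variable do too, with the last block enlarged by one. -/
theorem affineAut_up {n : ℕ} (hn : 0 < n) {S : Composition n} {I J : Finset ℕ}
    (hI : I ⊆ range (2 ^ n)) (hJ : J ⊆ range (2 ^ (n + 1)))
    (h : Closed n Set.univ (fam n I)) (hIJ : fam (n + 1) J = up (n + 1) (fam n I))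
    (hA : affineAut (polarCode n I) = BLTA S) :
    affineAut (polarCode (n + 1) J) = BLTA (growLast hn S) := by
  -- The assumed automorphism group is used only through the elementary maps at adjacent indices:
  -- they decide which thresholds are block starts.
  have hraise : ∀ k (hk : k + 1 < n), RaiseClosed (fam n I) k ↔ k + 1 ∉ blockStarts S := by
    intro k hk
    have hne : (⟨k + 1, hk⟩ : Fin n) ≠ ⟨k, by omega⟩ := by simp [Fin.ext_iff]
    rw [← pres_elemTransv_iff_raiseClosed h (fam_subset n I) hk, ← elemGA_apply _ _ hne,
      ← mem_affineAut' hI, hA, mem_BLTA_iff]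
    constructor
    · intro hg hT
      have := hg ⟨k, by omega⟩ ⟨k + 1, hk⟩ (k + 1) hT (Nat.lt_succ_self k) le_rfl
      rw [toMatrix'_elemGA] at this
      simp at this
    · intro hT i j l hl hi hj
      have h1 : i ≠ j := by rintro rfl; omega
      have h2 : ¬(i = ⟨k, by omega⟩ ∧ j = ⟨k + 1, hk⟩) := by
        rintro ⟨h1, h2⟩
        rw [h1] at hi
        rw [h2] at hj
        simp only at hi hj
        exact hT ((show l = k + 1 by omega) ▸ hl)
      rw [toMatrix'_elemGA, if_neg h1, if_neg h2, add_zero]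
  have hT : Closed n (blockStarts S) (fam n I) :=
    closed_of_raiseClosed h (zero_mem_blockStarts hn S) fun k hk => (hraise k hk).2
  have hup : Closed (n + 1) Set.univ (fam (n + 1) J) := hIJ ▸ h.up
  ext g
  rw [mem_BLTA_iff, blockStarts_growLast]
  constructor
  · intro hg i j k hk hi hj
    by_contra hne
    have hg1 := pres_linear hup (fam_subset _ J) ((mem_affineAut' hJ).1 hg)
    have hg2 := pres_linear hup (fam_subset _ J) ((mem_affineAut' hJ).1 (inv_mem hg))
    have hkn : k < n := by
      obtain ⟨m, hm, rfl⟩ := hk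
      exact (S.sizeUpTo_strict_mono hm).trans_le (S.sizeUpTo_le _)
    obtain ⟨l, rfl⟩ : ∃ l, k = l + 1 := ⟨k - 1, by omega⟩
    have h1 := hup.pres_elemTransv (fam_subset _ J) g.linear hg1 hg2 (k := l) (by omega) (i := i)
      (j := j) (by omega) (by omega) hne
    rw [pres_elemTransv_iff_raiseClosed hup (fam_subset _ J), hIJ] at h1
    exact (hraise l hkn).1 (raiseClosed_of_up (fam_subset n I) hkn h1) hk
  · intro hg
    rw [mem_affineAut' hJ]
    refine Closed.pres_affine ?_ (fam_subset _ J) hg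
    rw [hIJ]
    exact hT.up

/-! ### Minimum distance -/

/-- The number of points at which `f` does not vanish. -/
def weight {n : ℕ} (f : (Fin n → ZMod 2) → ZMod 2) : ℕ := #{z | f z ≠ 0}

theorem weight_mono {n : ℕ} {s : Finset ℕ} (hs : s ⊆ range n) :
    weight (mono n s) * 2 ^ #s = 2 ^ n := by
  have h0 : ∀ a : ZMod 2, 1 + a ≠ 0 ↔ a = 0 := by decide
  have h1 : ({z | mono n s z ≠ 0} : Finset (Fin n → ZMod 2)) =
      Fintype.piFinset fun i : Fin n => if (i : ℕ) ∈ s then {0} else univ := by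
    ext z
    simp only [mem_filter, mem_univ, true_and, mono, prod_ne_zero_iff, forall_const,
      Fintype.mem_piFinset]
    refine forall_congr' fun i => ?_
    split_ifs with hi <;> simp [h0]
  have h2 : (2 : ℕ) ^ #s = ∏ i : Fin n, if (i : ℕ) ∈ s then 2 else 1 := by
    rw [Fin.prod_univ_eq_prod_range (fun i => if i ∈ s then 2 else 1) n, ← prod_filter, prod_const,
      filter_mem_eq_inter, inter_eq_right.2 hs]
  rw [weight, h1, Fintype.card_piFinset, h2, ← prod_mul_distrib]
  rw [prod_congr rfl (g := fun _ => 2), prod_const, card_univ, Fintype.card_fin]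
  intro i _
  split_ifs <;> simp

theorem weight_succ {n : ℕ} (f : (Fin (n + 1) → ZMod 2) → ZMod 2) :
    weight f = weight (fun z : Fin n → ZMod 2 => f (Fin.snoc z 0)) +
      weight fun z : Fin n → ZMod 2 => f (Fin.snoc z 1) := by
  have hsum : ∀ (m : ℕ) (g : (Fin m → ZMod 2) → ZMod 2),
      weight g = ∑ z, if g z ≠ 0 then 1 else 0 := fun m g => card_filter _ _
  rw [hsum, hsum, hsum, ← (Fin.snocEquiv fun _ : Fin (n + 1) => ZMod 2).sum_comp,
    Fintype.sum_prod_type]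
  change ∑ a : Fin 2, _ = _
  rw [Fin.sum_univ_two]
  rfl

theorem weight_pos {n : ℕ} {f : (Fin n → ZMod 2) → ZMod 2} (hf : f ≠ 0) : 0 < weight f := by
  obtain ⟨z, hz⟩ := Function.ne_iff.1 hf
  exact card_pos.2 ⟨z, mem_filter.2 ⟨mem_univ z, hz⟩⟩

theorem mono_snoc {n : ℕ} (s : Finset ℕ) (z : Fin n → ZMod 2) (a : ZMod 2) :
    mono (n + 1) s (Fin.snoc z a) = mono n s z * if n ∈ s then 1 + a else 1 := by
  simp [mono, Fin.prod_univ_castSucc]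

theorem mono_erase_last {n : ℕ} (s : Finset ℕ) : mono n (s.erase n) = mono n s := by
  funext z
  refine prod_congr rfl fun i _ => ?_
  have : (i : ℕ) ≠ n := i.2.ne
  simp [this]

/-- The Plotkin decomposition: f restricts to g + h and g on the two halves of the cube, with h of
degree one less. -/
theorem exists_decomposition {n r : ℕ} {f : (Fin (n + 1) → ZMod 2) → ZMod 2}
    (hf : f ∈ code (n + 1) (ballFam (n + 1) (r + 1))) :
    ∃ g ∈ code n (ballFam n (r + 1)), ∃ h ∈ code n (ballFam n r),
      ∀ z a, f (Fin.snoc z a) = g z + (1 + a) * h z := by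
  induction hf using Submodule.span_induction with
  | mem f hf =>
    obtain ⟨s, hs, rfl⟩ := hf
    obtain ⟨hs, hc⟩ := mem_filter.1 (mem_coe.1 hs)
    have hs := mem_powerset.1 hs
    by_cases hn : n ∈ s
    · refine ⟨0, Submodule.zero_mem _, _, mono_mem_code (s := s.erase n) ?_, fun z a => ?_⟩
      · refine mem_filter.2 ⟨mem_powerset.2 ?_, ?_⟩
        · rw [range_add_one] at hs
          exact subset_insert_iff.1 hs
        · have := card_pos.2 ⟨n, hn⟩
          rw [card_erase_of_mem hn]
          omega
      · rw [mono_snoc, if_pos hn, mono_erase_last, Pi.zero_apply, zero_add, mul_comm]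
    · refine ⟨_, mono_mem_code (s := s) ?_, 0, Submodule.zero_mem _, fun z a => ?_⟩
      · rw [range_add_one] at hs
        exact mem_filter.2 ⟨mem_powerset.2 ((subset_insert_iff_of_notMem hn).1 hs), hc⟩
      · rw [mono_snoc, if_neg hn]
        simp
  | zero => exact ⟨0, Submodule.zero_mem _, 0, Submodule.zero_mem _, by simp⟩
  | add f f' _ _ hf hf' =>
    obtain ⟨g, hg, h, hh, hf⟩ := hf
    obtain ⟨g', hg', h', hh', hf'⟩ := hf'
    refine ⟨_, Submodule.add_mem _ hg hg', _, Submodule.add_mem _ hh hh', fun z a => ?_⟩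
    simp only [Pi.add_apply, hf, hf']
    ring
  | smul c f _ hf =>
    obtain ⟨g, hg, h, hh, hf⟩ := hf
    refine ⟨_, Submodule.smul_mem _ c hg, _, Submodule.smul_mem _ c hh, fun z a => ?_⟩
    simp only [Pi.smul_apply, hf, smul_eq_mul]
    ring

theorem code_mono {n : ℕ} {I J : Finset (Finset ℕ)} (h : I ⊆ J) : code n I ≤ code n J :=
  Submodule.span_mono (Set.image_mono (coe_subset.2 h))

/-- The minimum distance of Reed–Muller codes. -/
theorem two_pow_le_weight {n r : ℕ} {f : (Fin n → ZMod 2) → ZMod 2}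
    (hf : f ∈ code n (ballFam n r)) (h0 : f ≠ 0) : 2 ^ (n + 1) ≤ 2 ^ r * weight f := by
  have hzero : ∀ n (f : (Fin n → ZMod 2) → ZMod 2), f ∈ code n (ballFam n 0) → f = 0 := by
    intro n f hf
    simpa [ballFam, code] using hf
  induction n generalizing r with
  | zero =>
    cases r with
    | zero => exact absurd (hzero _ f hf) h0
    | succ r =>
      have := weight_pos h0
      have := Nat.one_le_two_pow (n := r)
      rw [zero_add, pow_one, pow_succ]
      nlinarith
  | succ n ih =>
    cases r with
    | zero => exact absurd (hzero _ f hf) h0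
    | succ r =>
      obtain ⟨g, hg, h, hh, hfz⟩ := exists_decomposition hf
      have e1 : (fun z : Fin n → ZMod 2 => f (Fin.snoc z 1)) = g := by
        funext z
        rw [hfz, show (1 : ZMod 2) + 1 = 0 from rfl, zero_mul, add_zero]
      have e0 : (fun z : Fin n → ZMod 2 => f (Fin.snoc z 0)) = g + h := by
        funext z
        rw [hfz, add_zero, one_mul]
        rfl
      have hsub : ballFam n r ⊆ ballFam n (r + 1) := fun s hs =>
        mem_filter.2 ⟨(mem_filter.1 hs).1, (mem_filter.1 hs).2.trans (Nat.lt_succ_self r)⟩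
      have hgh := Submodule.add_mem _ hg (code_mono hsub hh)
      rw [weight_succ, e0, e1]
      by_cases hg0 : g = 0
      · have hh0 : h ≠ 0 := by
          rintro rfl
          refine h0 (funext fun z => ?_)
          rw [← Fin.snoc_init_self z, hfz, hg0]
          simp
        have := ih hh hh0
        rw [hg0, zero_add, pow_succ _ r, pow_succ _ (n + 1)]
        nlinarith [Nat.zero_le (2 ^ r * weight (0 : (Fin n → ZMod 2) → ZMod 2))]
      -- If one half vanishes, the other is a nonzero word of the lower order code; if neither does,
      -- both weights are bounded by induction and add up.
      · by_cases hgh0 : g + h = 0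
        · have hgr : g ∈ code n (ballFam n r) := by
            rw [eq_neg_of_add_eq_zero_left hgh0]
            exact Submodule.neg_mem _ hh
          have := ih hgr hg0
          rw [hgh0, pow_succ _ r, pow_succ _ (n + 1)]
          nlinarith [Nat.zero_le (2 ^ r * weight (0 : (Fin n → ZMod 2) → ZMod 2))]
        · have h1 := ih hg hg0
          have h2 := ih hgh hgh0
          rw [pow_succ _ (n + 1)]
          nlinarith

theorem hammingNorm_comp_bitsEquiv {n : ℕ} (f : (Fin n → ZMod 2) → ZMod 2) :
    hammingNorm (f ∘ bitsEquiv n) = weight f := by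
  unfold hammingNorm weight
  refine card_equiv (bitsEquiv n) fun i => ?_
  simp

theorem minDist_le {n : ℕ} {J : Finset ℕ} (hJ : J ⊆ range (2 ^ n)) {s : Finset ℕ}
    (hs : s ∈ fam n J) : minDist (polarCode n J) * 2 ^ #s ≤ 2 ^ n := by
  have hsn := mem_powerset.1 (fam_subset n J hs)
  refine (Nat.mul_le_mul_right _ ?_).trans_eq (weight_mono hsn)
  refine (Nat.sInf_le ⟨mono n s ∘ bitsEquiv n,
    (comp_bitsEquiv_mem hJ).2 (mono_mem_code hs), 0, Submodule.zero_mem _, ?_, ?_⟩)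
  · intro h
    have hw := weight_mono hsn
    rw [← hammingNorm_comp_bitsEquiv, h, hammingNorm_zero, zero_mul] at hw
    exact absurd hw.symm (by positivity)
  · rw [hammingDist_zero_right, hammingNorm_comp_bitsEquiv]

theorem le_minDist {n r : ℕ} {J : Finset ℕ} (hJ : J ⊆ range (2 ^ n)) (hne : J.Nonempty)
    (h : fam n J ⊆ ballFam n r) : 2 ^ (n + 1) ≤ 2 ^ r * minDist (polarCode n J) := by
  obtain ⟨x, hx, y, hy, hxy, hd⟩ : minDist (polarCode n J) ∈
      {d | ∃ x ∈ polarCode n J, ∃ y ∈ polarCode n J, x ≠ y ∧ hammingDist x y = d} := by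
    refine Nat.sInf_mem ?_
    obtain ⟨l, hl⟩ := hne
    have hs := mem_image_of_mem (nvars n) hl
    refine ⟨_, mono n (nvars n l) ∘ bitsEquiv n, (comp_bitsEquiv_mem hJ).2 (mono_mem_code hs), 0,
      Submodule.zero_mem _, fun h => ?_, rfl⟩
    have hw := weight_mono (nvars_subset n l)
    rw [← hammingNorm_comp_bitsEquiv, h, hammingNorm_zero, zero_mul] at hw
    exact absurd hw.symm (by positivity)
  have hxy' : -x + y ≠ 0 := fun h0 => hxy (neg_add_eq_zero.1 h0)
  have hmem := code_mono h ((mem_polarCode hJ).1 (Submodule.add_mem _ (Submodule.neg_mem _ hx) hy))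
  have heq : ((-x + y) ∘ (bitsEquiv n).symm) ∘ bitsEquiv n = -x + y := by
    rw [Function.comp_assoc, Equiv.symm_comp_self, Function.comp_id]
  have hw := two_pow_le_weight hmem fun h0 => hxy' (by rw [← heq, h0]; rfl)
  rwa [← hammingNorm_comp_bitsEquiv, heq, ← hammingDist_eq_hammingNorm, hd] at hw

/-- An RM-polar code that involves a monomial of degree `r` is larger than the Reed–Muller code of
order `r - 1`. -/
theorem IsRMPolar.card_ballFam_lt {n r : ℕ} {I : Finset ℕ} (h : IsRMPolar n I) {s : Finset ℕ}
    (hs : s ∈ fam n I) (hr : #s = r) : #(ballFam n r) < #I := by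
  by_contra! hle
  -- A family of the same size inside the ball would have distance at least 2^(n+1-r), whereas the
  -- monomial s bounds that of I by 2^(n-r).
  obtain ⟨J', hJ', hc⟩ := exists_subset_card_eq hle
  obtain ⟨J, hJ, rfl⟩ := exists_fam_eq (hJ'.trans (filter_subset _ _))
  rw [card_fam hJ] at hc
  have hne : J.Nonempty := by
    rw [← card_pos, hc, ← card_fam h.1]
    exact card_pos.2 ⟨s, hs⟩
  have h1 := h.2 J hJ hc
  have h2 := minDist_le h.1 hs
  have h3 := le_minDist hJ hne hJ'
  rw [hr] at h2
  rw [pow_succ] at h3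
  have h4 : 0 < 2 ^ n := by positivity
  nlinarith [Nat.mul_le_mul_left (2 ^ r) h1]

/-- By pigeonhole, any competitor contains a monomial of degree at least r, hence has distance at
most 2^(n-r), which the code of I attains or exceeds. -/
theorem isRMPolar_of_card_lt {n r : ℕ} {I : Finset ℕ} (hI : I ⊆ range (2 ^ n))
    (hr : fam n I ⊆ ballFam n (r + 1)) (hc : #(ballFam n r) < #I) : IsRMPolar n I := by
  refine ⟨hI, fun J hJ hJc => ?_⟩
  have h1 := le_minDist hI (card_pos.1 (by omega)) hr
  obtain ⟨s, hs, hsr⟩ : ∃ s ∈ fam n J, r ≤ #s := by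
    by_contra! hno
    have := card_le_card (show fam n J ⊆ ballFam n r from fun s hs =>
      mem_filter.2 ⟨fam_subset n J hs, hno s hs⟩)
    rw [card_fam hJ] at this
    omega
  have h2 := minDist_le hJ hs
  have h3 := Nat.pow_le_pow_right (n := 2) (by norm_num) hsr
  rw [pow_succ, pow_succ] at h1
  have h4 : 0 < 2 ^ r := by positivity
  by_contra! hlt
  nlinarith [Nat.mul_le_mul_left (minDist (polarCode n J)) h3]

theorem isRMPolar_up {n : ℕ} {I J : Finset ℕ} (hJ : J ⊆ range (2 ^ (n + 1)))
    (h : Closed n Set.univ (fam n I)) (hIJ : fam (n + 1) J = up (n + 1) (fam n I))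
    (hRM : IsRMPolar n I) : IsRMPolar (n + 1) J := by
  rcases (fam n I).eq_empty_or_nonempty with he | hne
  -- For the zero code the only competitor is itself.
  · have : J = ∅ := by
      rw [he] at hIJ
      simpa [up, fam] using hIJ
    subst this
    refine ⟨hJ, fun J' _ hc => ?_⟩
    rw [card_empty, card_eq_zero] at hc
    rw [hc]
  · obtain ⟨s, hs, hmax⟩ := exists_max_image _ card hne
    have h1 := hRM.card_ballFam_lt hs rfl
    rw [← card_fam hRM.1] at h1
    have h2 := card_ballFam_lt_card_up hne (fam_subset n I) h h1
    rw [← hIJ, card_fam hJ] at h2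
    refine isRMPolar_of_card_lt hJ (fun t ht => mem_filter.2 ⟨fam_subset _ J ht, ?_⟩) h2
    rw [hIJ, mem_up] at ht
    have h3 := hmax _ ht.2
    have h4 := cnt_tail t 0
    rw [cnt_zero, cnt_zero] at h4
    omega

end RMPSC

theorem theorem1 (n : ℕ) (hn : 0 < n) (S : Composition n) (Imin : Finset ℕ)
    (hmin : RMPSC.IsMinInfoSet n Imin)
    (hRM : RMPSC.IsRMPolar n (RMPSC.infoSet n Imin))
    (hA : RMPSC.affineAut (RMPSC.polarCode n (RMPSC.infoSet n Imin)) = RMPSC.BLTA S) :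
    RMPSC.IsMinInfoSet (n + 1) Imin ∧
      RMPSC.IsRMPSC (n + 1) (RMPSC.infoSet (n + 1) Imin) ∧
      RMPSC.affineAut (RMPSC.polarCode (n + 1) (RMPSC.infoSet (n + 1) Imin)) =
        RMPSC.BLTA (RMPSC.growLast hn S) := by
  have hI := RMPSC.infoSet_subset n Imin
  have hJ := RMPSC.infoSet_subset (n + 1) Imin
  have hcl := RMPSC.closed_fam_infoSet n Imin
  have hIJ := RMPSC.fam_infoSet_succ hmin.1
  refine ⟨hmin.succ, ⟨RMPSC.isRMPolar_up hJ hcl hIJ hRM, ?_⟩,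
    RMPSC.affineAut_up hn hI hJ hcl hIJ hA⟩
  have h2 : 2 ≤ RMPSC.symmetry (n + 1) (RMPSC.infoSet (n + 1) Imin) := by
    obtain ⟨m, rfl⟩ : ∃ m, n = m + 1 := ⟨n - 1, by omega⟩
    refine RMPSC.two_le_symmetry hJ (RMPSC.closed_fam_infoSet _ Imin) ?_
    rw [hIJ]
    exact RMPSC.raiseClosed_up_last
  have hle : RMPSC.symmetry (n + 1) (RMPSC.infoSet (n + 1) Imin) ≤ n + 1 :=
    (Finset.card_le_univ _).trans_eq (Fintype.card_fin _)
  rcases hle.lt_or_eq with hlt | heq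
  · exact Or.inl ⟨h2, hlt⟩
  · exact Or.inr heq
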